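/- Let $E$ and $F$ be Polish spaces with their Borel $\sigma$-fields, and for each $x\in F$ let $P_x$ be a Markov kernel on $E$ such that $(x,y)\mapsto P_x(y,A)$ is measurable for every $A\in\mathcal B(E)$. Let $X=(X_t)_{t\in\mathbb Z}$ be an $F$-valued process on a probability space. Assume the following. A1. $X$ is stationary. A2. There are a measurable $V:E\to(0,\infty)$ and measurable $\lambda,b:F\to[0,\infty)$ with $\mathbb E[\log^+\lambda(X_0)]<\infty$ and $\mathbb E[\log^+ b(X_0)]<\infty$, where $\log^+ u=\log\max(u,1)$, such that for all $(x,y)\in F\times E$ $$P_xV(y):=\int_E V(y')\,P_x(y,dy')\le\lambda(x)V(y)+b(x),$$ and $$\limsup_{n\to\infty}\Big(\prod_{i=1}^n\lambda(X_{-i})\Big)^{1/n}<1\quad\text{a.s.}$$ A3. There is a measurable $\eta:(0,\infty)\times F\to(0,1)$ such that for every $R>0$ there is a probability kernel $\nu_R$ from $F$ to $E$ with $$P_x(y,A)\ge\eta(R,x)\,\nu_R(x,A)\quad\text{for all }x\in F,\ y\in E\text{ with }V(y)\le R,\ A\in\mathcal B(E).$$ Then there exists, on a suitable probability space, a stationary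 $E\times F$-valued process $((Y_t,X_t))_{t\in\mathbb Z}$ whose second component has the law of the given environment $X$ (and is again denoted by $X$) and which satisfies, for all $t\in\mathbb Z$ and $A\in\mathcal B(E)$, $$\mathbb P\big(Y_t\in A\mid X,Y_{t-1},Y_{t-2},\ldots\big)=P_{X_{t-1}}(Y_{t-1},A)\quad\text{a.s.},\qquad(1)$$ where the conditioning is on the whole environment $(X_s)_{s\in\mathbb Z}$ and on all $Y_s$ with $s<t$. The law on $(E\times F)^{\mathbb Z}$ of such a process is unique: any two stationary processes satisfying (1), on any probability spaces, whose second components have the law of the given environment, have the same law. If in addition $X$ is ergodic (every measurable shift-invariant subset of $F^{\mathbb Z}$ has probability $0$ or $1$ under the law of $X$), then the process $((Y_t,X_t))_{t\in\mathbb Z}$ is ergodic. -/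

import Mathlib

open MeasureTheory ProbabilityTheory Filter
open scoped ENNReal NNReal

namespace MCRE

/-- The law, on the path space with its product sigma-algebra, of a process indexed by the
integers. -/
noncomputable def pathLaw {Ω S : Type*} [MeasurableSpace Ω] [MeasurableSpace S]
    (μ : Measure Ω) (Z : ℤ → Ω → S) : Measure (ℤ → S) :=
  μ.map (fun ω t => Z t ω)

/-- The shift of two-sided sequences. -/
def shift {S : Type*} (z : ℤ → S) : ℤ → S := fun t => z (t + 1)

/-- A stationary process: random variables whose joint law is invariant under time
translations. -/
structure IsStationaryProcess {Ω S : Type*} [MeasurableSpace Ω] [MeasurableSpace S]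
    (μ : Measure Ω) (Z : ℤ → Ω → S) : Prop where
  measurable : ∀ t, Measurable (Z t)
  translate : ∀ h : ℤ, pathLaw μ (fun t => Z (t + h)) = pathLaw μ Z

/-- An ergodic process: the shift preserves its law, and every measurable set invariant under the
shift has probability zero or one. -/
def IsErgodicProcess {Ω S : Type*} [MeasurableSpace Ω] [MeasurableSpace S]
    (μ : Measure Ω) (Z : ℤ → Ω → S) : Prop :=
  Ergodic (shift (S := S)) (pathLaw μ Z)

/-- The sigma-algebra generated by the whole environment `X` and by the `Y s` with `s < t`. -/
abbrev envPast {Ω E F : Type*} [MeasurableSpace E] [MeasurableSpace F]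
    (Y : ℤ → Ω → E) (X : ℤ → Ω → F) (t : ℤ) : MeasurableSpace Ω :=
  (⨆ s : ℤ, MeasurableSpace.comap (X s) inferInstance) ⊔
    (⨆ s : ℤ, ⨆ _ : s < t, MeasurableSpace.comap (Y s) inferInstance)

/-- `Y` is a Markov chain in the random environment `X` with kernels `P_x = P (x, ·)`: for all `t`
and all measurable `A`, almost surely,
`ℙ(Y_t ∈ A | X, Y_{t-1}, Y_{t-2}, …) = P_{X_{t-1}}(Y_{t-1}, A)`. -/
structure IsChainInEnvironment {Ω E F : Type*} [MeasurableSpace Ω] [MeasurableSpace E]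
    [MeasurableSpace F] (P : Kernel (F × E) E) (μ : Measure Ω)
    (Y : ℤ → Ω → E) (X : ℤ → Ω → F) : Prop where
  measurable_chain : ∀ t, Measurable (Y t)
  measurable_env : ∀ t, Measurable (X t)
  condProb : ∀ (t : ℤ) (A : Set E), MeasurableSet A →
    μ⟦Y t ⁻¹' A | envPast Y X t⟧ =ᵐ[μ] fun ω => (P (X (t - 1) ω, Y (t - 1) ω)).real A

/-- `(Y, X)` is a stationary process, its environment `X` has the prescribed law, and `Y` is a
Markov chain in the environment `X` with kernels `P`. -/
structure IsStationarySolution {Ω E F : Type*} [MeasurableSpace Ω] [MeasurableSpace E]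
    [MeasurableSpace F] (P : Kernel (F × E) E) (envLaw : Measure (ℤ → F)) (μ : Measure Ω)
    (Y : ℤ → Ω → E) (X : ℤ → Ω → F) : Prop where
  stationary : IsStationaryProcess μ (fun t ω => (Y t ω, X t ω))
  env_law : pathLaw μ X = envLaw
  chain : IsChainInEnvironment P μ Y X

/-- Nonnegative measurable coefficients `γ` on the environment space with
`𝔼[log⁺ γ(X_0)] < ∞`. -/
structure HasLogMoment {Ω F : Type*} [MeasurableSpace Ω] [MeasurableSpace F]
    (μ : Measure Ω) (X : ℤ → Ω → F) (γ : F → ℝ≥0) : Prop where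
  measurable : Measurable γ
  integrable : Integrable (fun ω => Real.posLog (γ (X 0 ω))) μ

/-- The drift condition `P_x V ≤ lam(x) V + b(x)` with coefficients having logarithmic moments and
with `limsup_n (∏_{i=1}^n lam(X_{-i}))^{1/n} < 1` almost surely. -/
structure DriftCondition {Ω E F : Type*} [MeasurableSpace Ω] [MeasurableSpace E]
    [MeasurableSpace F] (P : Kernel (F × E) E) (μ : Measure Ω) (X : ℤ → Ω → F)
    (V : E → ℝ≥0) (lam b : F → ℝ≥0) : Prop where
  measurable : Measurable V
  pos : ∀ y, 0 < V y
  logMoment_lam : HasLogMoment μ X lam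
  logMoment_b : HasLogMoment μ X b
  drift : ∀ x y, ∫⁻ y', (V y' : ℝ≥0∞) ∂(P (x, y)) ≤ lam x * V y + b x
  contraction : ∀ᵐ ω ∂μ,
    limsup (fun n : ℕ =>
      (∏ i ∈ Finset.Icc 1 n, (lam (X (-(i : ℤ)) ω) : ℝ≥0∞)) ^ (1 / (n : ℝ))) atTop < 1

/-- The small set condition: for every `R > 0` there is a probability kernel `ν` from `F` to `E`
with `P_x(y, A) ≥ η(R, x) ν(x, A)` whenever `V y ≤ R`, where `η` is measurable with values in
`(0, 1)`. -/
structure SmallSetCondition {E F : Type*} [MeasurableSpace E] [MeasurableSpace F]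
    (P : Kernel (F × E) E) (V : E → ℝ≥0) (η : ℝ≥0 → F → ℝ≥0) : Prop where
  measurable : Measurable (Function.uncurry η)
  mem_Ioo : ∀ R, 0 < R → ∀ x, η R x ∈ Set.Ioo 0 1
  minorization : ∀ R, 0 < R → ∃ ν : Kernel F E, IsMarkovKernel ν ∧
    ∀ x y, V y ≤ R → ∀ A, MeasurableSet A → (η R x : ℝ≥0∞) * ν x A ≤ P (x, y) A

end MCRE

/-! Carry the whole environment along: the pair (environment seen from the present, present state)
is a Markov chain on `(ℤ → F) × E` whose kernel T, an instance of `skewKernel`, shifts the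
environment and moves the state by `P`. Stationary solutions correspond to T-invariant probability
measures over the law ρ of the environment. These are handled by order and mass arguments: a Markov
kernel preserves mass, so mT ≤ m already gives mT = m for finite m.

Uniqueness (`eq_of_invariant`). The meet k of two invariant measures m, m' over ρ satisfies kT ≤ m
and kT ≤ m', so it is invariant. The remainders m - k and m' - k are then invariant, carried by
complementary sets, and have the same base marginal. If they were nonzero, most of that marginal
would consist of environments x for which both remainders see the level set V ≤ R; the minorizing
probability ν_x would then vanish on both complementary sets.

Existence (`exists_invariant`). The laws of the chain started at a fixed state have a Banach limit
L, finitely additive and T-invariant. The largest measure m below L is invariant because mT is again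
below L. If m lost mass, tightness would leave some of L - m over a slab V ≤ R. There L is countably
additive in the environment, being dominated by ρ, and one transition turns the excess, through the
minorization, into a nonzero measure γ with m + γ ≤ L, against maximality.

Tightness (`tight_iterLaw`) comes from the quenched drift bounds ∏lam · V(y₀) + ∑ ∏lam · b, which
are almost surely bounded in n: the products decay geometrically and b grows subexponentially
(Borel–Cantelli).

An invariant measure extends backwards by disintegrating the reversed transition
(`exists_invariant_past`) and forwards by running the chain (`exists_isInvariantChain`). The path
law is determined by the law of the environment and present state (`IsInvariantChain.ext`).

Ergodicity. A shift-invariant event is approximable by events of the past, so conditioning on it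
keeps the transitions (`IsInvariantChain.cond`). The conditioned environment is invariant and
absolutely continuous with respect to an ergodic law, hence equal to it; uniqueness then gives the
event probability one. -/

namespace MCRE

/-! ### Skew kernels and uniqueness of invariant measures -/

section Skew

variable {S E : Type*} [MeasurableSpace S] [MeasurableSpace E]

/-- The transition kernel on `S × E` which moves the environment deterministically by `θ` and the
second coordinate according to `κ`. -/
noncomputable def skewKernel {θ : S → S} (hθ : Measurable θ) (κ : Kernel (S × E) E) :
    Kernel (S × E) (S × E) :=
  Kernel.deterministic (fun w : S × E => θ w.1) (hθ.comp measurable_fst) ×ₖ κ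

instance {θ : S → S} (hθ : Measurable θ) (κ : Kernel (S × E) E) [IsMarkovKernel κ] :
    IsMarkovKernel (skewKernel hθ κ) := by
  unfold skewKernel; infer_instance

theorem lintegral_skewKernel {θ : S → S} (hθ : Measurable θ) (κ : Kernel (S × E) E)
    [IsMarkovKernel κ] (w : S × E) {f : S × E → ℝ≥0∞} (hf : Measurable f) :
    ∫⁻ z, f z ∂(skewKernel hθ κ w) = ∫⁻ y, f (θ w.1, y) ∂(κ w) := by
  rw [skewKernel, Kernel.lintegral_deterministic_prod _ _ _ hf]

theorem skewKernel_apply {θ : S → S} (hθ : Measurable θ) (κ : Kernel (S × E) E)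
    [IsMarkovKernel κ] (w : S × E) {A : Set (S × E)} (hA : MeasurableSet A) :
    skewKernel hθ κ w A = κ w (Prod.mk (θ w.1) ⁻¹' A) := by
  rw [← lintegral_indicator_one hA, lintegral_skewKernel hθ κ w (measurable_one.indicator hA),
    ← lintegral_indicator_one (measurable_prodMk_left hA)]
  rfl

/-- The local minorization condition for a kernel on `E` depending on an environment in `S`. -/
def HasSmallSets (κ : Kernel (S × E) E) (V : E → ℝ≥0) : Prop :=
  ∀ R : ℝ≥0, 0 < R → ∃ η : S → ℝ≥0∞, Measurable η ∧ (∀ x, 0 < η x) ∧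
    ∃ ν : Kernel S E, IsMarkovKernel ν ∧
      ∀ x y, V y ≤ R → ∀ A, MeasurableSet A → η x * ν x A ≤ κ (x, y) A

theorem bind_mono_left {α β : Type*} [MeasurableSpace α] [MeasurableSpace β]
    {m m' : Measure α} (h : m ≤ m') (κ : Kernel α β) : m.bind κ ≤ m'.bind κ := by
  refine Measure.le_iff.2 fun s hs => ?_
  rw [Measure.bind_apply hs κ.aemeasurable, Measure.bind_apply hs κ.aemeasurable]
  exact lintegral_mono' h le_rfl

/-- Both measures have the same finite total mass, so the inequality cannot be strict on any set. -/
theorem bind_eq_of_bind_le {α : Type*} [MeasurableSpace α] {m : Measure α} [IsFiniteMeasure m]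
    {κ : Kernel α α} [IsMarkovKernel κ] (h : m.bind κ ≤ m) : m.bind κ = m := by
  refine Measure.eq_of_le_of_measure_univ_eq h ?_
  rw [Measure.bind_apply .univ κ.aemeasurable]
  simp

theorem exists_measure_superlevel_lt {α : Type*} [MeasurableSpace α] (m : Measure α)
    [IsFiniteMeasure m] {V : α → ℝ≥0} (hV : Measurable V) {ε : ℝ≥0∞} (hε : 0 < ε) :
    ∃ R₀ : ℝ≥0, ∀ R, R₀ ≤ R → m {a | R < V a} < ε := by
  have hanti : Antitone fun n : ℕ => {a | (n : ℝ≥0) < V a} := fun i j hij a ha => by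
    rw [Set.mem_ofPred_eq] at ha ⊢
    exact lt_of_le_of_lt (Nat.cast_le.2 hij) ha
  have hm : ∀ n : ℕ, MeasurableSet {a | (n : ℝ≥0) < V a} := fun n =>
    measurableSet_lt measurable_const hV
  have h := tendsto_measure_iInter_atTop (μ := m) (fun n => (hm n).nullMeasurableSet) hanti
    ⟨0, measure_ne_top _ _⟩
  have he : (⋂ n : ℕ, {a | (n : ℝ≥0) < V a}) = ∅ := by
    refine Set.eq_empty_iff_forall_notMem.2 fun a ha => ?_
    obtain ⟨n, hn⟩ := exists_nat_gt (V a)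
    exact lt_asymm hn (Set.mem_iInter.1 ha n)
  rw [he, measure_empty] at h
  obtain ⟨n, hn⟩ := (h.eventually (gt_mem_nhds hε)).exists
  exact ⟨n, fun R hR => lt_of_le_of_lt (measure_mono fun a ha => lt_of_le_of_lt hR ha) hn⟩

/-- If an invariant measure does not charge `D`, then over most of the base the minorizing
measures do not charge the fibres of `D`. -/
theorem measure_fibre_ne_zero_le {θ : S → S} (hθ : Measurable θ) (κ : Kernel (S × E) E)
    [IsMarkovKernel κ] {V : E → ℝ≥0} {α : Measure (S × E)} [IsFiniteMeasure α]
    (hα : α.bind (skewKernel hθ κ) = α) {D : Set (S × E)} (hD : MeasurableSet D) (h0 : α D = 0)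
    {R : ℝ≥0} {η : S → ℝ≥0∞} (hηpos : ∀ x, 0 < η x) (ν : Kernel S E) [IsMarkovKernel ν]
    (hmin : ∀ x y, V y ≤ R → ∀ A, MeasurableSet A → η x * ν x A ≤ κ (x, y) A) :
    α.map Prod.fst {x | ν x (Prod.mk (θ x) ⁻¹' D) ≠ 0} ≤ α {w | R < V w.2} := by
  have hmeas : Measurable fun x => ν x (Prod.mk (θ x) ⁻¹' D) := by
    have : MeasurableSet ((fun p : S × E => (θ p.1, p.2)) ⁻¹' D) :=
      (by fun_prop : Measurable fun p : S × E => (θ p.1, p.2)) hD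
    exact Kernel.measurable_kernel_prodMk_left this
  have hset : MeasurableSet {x | ν x (Prod.mk (θ x) ⁻¹' D) ≠ 0} :=
    (measurableSet_eq_fun hmeas measurable_const).compl
  rw [Measure.map_apply measurable_fst hset]
  -- By invariance, `α D = 0` says that almost every point jumps into `D` with probability zero; at
  -- a point with V ≤ R the minorization passes this on to ν.
  rw [← hα, Measure.bind_apply hD (Kernel.aemeasurable _),
    lintegral_eq_zero_iff (Kernel.measurable_coe _ hD)] at h0
  refine measure_mono_ae ?_
  filter_upwards [h0] with w hw hne
  by_contra hR
  have hR' : V w.2 ≤ R := not_lt.1 hR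
  rw [skewKernel_apply hθ κ w hD] at hw
  have := hmin w.1 w.2 hR' _ (measurable_prodMk_left (x := θ w.1) hD)
  rw [show ((w.1, w.2) : S × E) = w from rfl, hw] at this
  simp only [Pi.zero_apply, nonpos_iff_eq_zero, mul_eq_zero, (hηpos w.1).ne', false_or] at this
  exact hne this

/-- Invariant finite measures of the skew kernel are determined by their marginal on the base. -/
theorem eq_of_invariant {θ : S → S} (hθ : Measurable θ) (κ : Kernel (S × E) E)
    [IsMarkovKernel κ] {V : E → ℝ≥0} (hV : Measurable V) (hs : HasSmallSets κ V)
    {m m' : Measure (S × E)} [IsFiniteMeasure m] [IsFiniteMeasure m']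
    (hm : m.bind (skewKernel hθ κ) = m) (hm' : m'.bind (skewKernel hθ κ) = m')
    (hmarg : m.map Prod.fst = m'.map Prod.fst) : m = m' := by
  obtain ⟨D, hD⟩ := exists_isHahnDecomposition m m'
  have hDm := hD.measurableSet
  set T := skewKernel hθ κ
  -- On `D` the smaller measure is `m`, on the complement it is `m'`, so `k` is their meet.
  set k := m.restrict D + m'.restrict Dᶜ with hk
  have hkm : k ≤ m := by
    rw [← Measure.restrict_add_restrict_compl (μ := m) hDm]
    exact add_le_add le_rfl hD.ge_on_compl
  have hkm' : k ≤ m' := by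
    rw [← Measure.restrict_add_restrict_compl (μ := m') hDm]
    exact add_le_add hD.le_on le_rfl
  have hmax : ∀ g : Measure (S × E), g ≤ m → g ≤ m' → g ≤ k := fun g h1 h2 => by
    rw [← Measure.restrict_add_restrict_compl (μ := g) hDm]
    exact add_le_add (Measure.restrict_mono le_rfl h1) (Measure.restrict_mono le_rfl h2)
  have hkinv : k.bind T = k := by
    refine bind_eq_of_bind_le (hmax _ ?_ ?_)
    · exact (bind_mono_left hkm T).trans hm.le
    · exact (bind_mono_left hkm' T).trans hm'.le
  have cancel : ∀ {a b c : Measure (S × E)} [IsFiniteMeasure c], a + c = b + c → a = b := by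
    intro a b c _ h
    ext s hs
    have := congrArg (fun μ : Measure (S × E) => μ s) h
    simpa using this
  have hsub : ∀ n : Measure (S × E), IsFiniteMeasure n → n.bind T = n → k ≤ n →
      (n - k).bind T = n - k := by
    intro n _ hn hkn
    refine cancel (c := k) ?_
    conv_lhs => rw [← hkinv]
    rw [hkinv, Measure.sub_add_cancel_of_le hkn]
    conv_rhs => rw [← hn, ← Measure.sub_add_cancel_of_le hkn]
    rw [Measure.comp_add, hkinv]
  have hα := hsub m inferInstance hm hkm
  have hβ := hsub m' inferInstance hm' hkm'
  have hαD : (m - k) D = 0 := by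
    rw [Measure.sub_apply hDm hkm]; simp [hk, hDm]
  have hβD : (m' - k) Dᶜ = 0 := by
    rw [Measure.sub_apply hDm.compl hkm']; simp [hk, hDm.compl]
  have hσ : (m - k).map Prod.fst = (m' - k).map Prod.fst := by
    have h1 : (m - k).map Prod.fst + k.map Prod.fst = (m' - k).map Prod.fst + k.map Prod.fst := by
      rw [← Measure.map_add _ _ measurable_fst, ← Measure.map_add _ _ measurable_fst,
        Measure.sub_add_cancel_of_le hkm, Measure.sub_add_cancel_of_le hkm', hmarg]
    ext s hs
    have := congrArg (fun μ : Measure S => μ s) h1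
    simpa using this
  set α := m - k
  set β := m' - k
  set σ := α.map Prod.fst with hσdef
  have hαβ : α Set.univ = 0 := by
    by_contra hne
    have hσu : σ Set.univ = α Set.univ := by
      rw [hσdef, Measure.map_apply measurable_fst .univ, Set.preimage_univ]
    have hpos : 0 < σ Set.univ / 2 := by rw [hσu]; exact ENNReal.half_pos hne
    obtain ⟨R1, hR1⟩ := exists_measure_superlevel_lt α (hV.comp measurable_snd) hpos
    obtain ⟨R2, hR2⟩ := exists_measure_superlevel_lt β (hV.comp measurable_snd) hpos
    set R := max (max R1 R2) 1
    obtain ⟨η, -, hηpos, ν, hν, hmin⟩ := hs R (lt_of_lt_of_le one_pos (le_max_right _ _))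
    have h1 := measure_fibre_ne_zero_le hθ κ hα hDm hαD hηpos ν hmin
    have h2 := measure_fibre_ne_zero_le hθ κ hβ hDm.compl hβD hηpos ν hmin
    rw [← hσ] at h2
    -- A probability `ν x` cannot vanish on a set and on its complement, yet each of the two
    -- covering sets has less than half of the mass of σ.
    have hcov : (Set.univ : Set S) ⊆ {x | ν x (Prod.mk (θ x) ⁻¹' D) ≠ 0} ∪
        {x | ν x (Prod.mk (θ x) ⁻¹' Dᶜ) ≠ 0} := by
      intro x _
      by_contra hx
      simp only [Set.mem_union, Set.mem_ofPred_eq, not_or, not_not] at hx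
      have := prob_add_prob_compl (μ := ν x) (measurable_prodMk_left (x := θ x) hDm)
      rw [← Set.preimage_compl, hx.1, hx.2] at this
      simp at this
    have h3 : σ Set.univ < σ Set.univ / 2 + σ Set.univ / 2 :=
      calc σ Set.univ ≤ _ := measure_mono hcov
        _ ≤ _ := measure_union_le _ _
        _ ≤ _ := add_le_add h1 h2
        _ < _ := ENNReal.add_lt_add
          (hR1 R ((le_max_left _ _).trans (le_max_left _ _)))
          (hR2 R ((le_max_right _ _).trans (le_max_left _ _)))
    rw [ENNReal.add_halves] at h3
    exact lt_irrefl _ h3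
  have hββ : β Set.univ = 0 := by
    have : β.map Prod.fst Set.univ = 0 := by
      rw [← hσ, hσdef, Measure.map_apply measurable_fst .univ, Set.preimage_univ, hαβ]
    rwa [Measure.map_apply measurable_fst .univ, Set.preimage_univ] at this
  rw [← Measure.sub_add_cancel_of_le hkm, ← Measure.sub_add_cancel_of_le hkm']
  change α + k = β + k
  rw [Measure.measure_univ_eq_zero.1 hαβ, Measure.measure_univ_eq_zero.1 hββ]

end Skew


/-! ### Banach limits -/

section BanachLimit

/-- Cesàro averages of a sequence. -/
noncomputable def cesaro (a : ℕ → ℝ≥0∞) (n : ℕ) : ℝ≥0∞ :=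
  ((n : ℝ≥0∞) + 1)⁻¹ * ∑ k ∈ Finset.range (n + 1), a k

/-- A generalized limit: the limit of the Cesàro averages along a free ultrafilter. -/
noncomputable def banachLim (a : ℕ → ℝ≥0∞) : ℝ≥0∞ :=
  ((hyperfilter ℕ).map (cesaro a)).lim

/-- `ℝ≥0∞` is compact, so every ultrafilter on it converges. -/
theorem tendsto_banachLim (a : ℕ → ℝ≥0∞) :
    Tendsto (cesaro a) (hyperfilter ℕ : Filter ℕ) (nhds (banachLim a)) :=
  Ultrafilter.le_nhds_lim ((hyperfilter ℕ).map (cesaro a))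

theorem banachLim_add (a b : ℕ → ℝ≥0∞) :
    banachLim (fun k => a k + b k) = banachLim a + banachLim b := by
  refine tendsto_nhds_unique (tendsto_banachLim _)
    (((tendsto_banachLim a).add (tendsto_banachLim b)).congr fun n => ?_)
  simp only [cesaro, Finset.sum_add_distrib, mul_add]

theorem banachLim_const_mul (c : ℝ≥0) (a : ℕ → ℝ≥0∞) :
    banachLim (fun k => c * a k) = c * banachLim a := by
  refine tendsto_nhds_unique (tendsto_banachLim _)
    ((ENNReal.Tendsto.const_mul (tendsto_banachLim a) (Or.inr ENNReal.coe_ne_top)).congr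
      fun n => ?_)
  simp only [cesaro, ← Finset.mul_sum]
  ring

theorem banachLim_mono {a b : ℕ → ℝ≥0∞} (h : ∀ k, a k ≤ b k) : banachLim a ≤ banachLim b :=
  le_of_tendsto_of_tendsto' (tendsto_banachLim a) (tendsto_banachLim b) fun n => by
    unfold cesaro
    gcongr
    exact h _

theorem banachLim_const (c : ℝ≥0∞) : banachLim (fun _ => c) = c := by
  refine tendsto_nhds_unique (tendsto_banachLim _) (tendsto_const_nhds.congr fun n => ?_)
  have h1 : (n : ℝ≥0∞) + 1 ≠ 0 := by simp
  have h2 : (n : ℝ≥0∞) + 1 ≠ ⊤ := by finiteness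
  rw [cesaro, Finset.sum_const, Finset.card_range, nsmul_eq_mul, ← mul_assoc, Nat.cast_add,
    Nat.cast_one, ENNReal.inv_mul_cancel h1 h2, one_mul]

theorem banachLim_le_const {a : ℕ → ℝ≥0∞} {c : ℝ≥0∞} (h : ∀ k, a k ≤ c) : banachLim a ≤ c :=
  (banachLim_mono h).trans (banachLim_const c).le

theorem banachLim_sum (a : ℕ → ℕ → ℝ≥0∞) (n : ℕ) :
    banachLim (fun k => ∑ i ∈ Finset.range n, a i k) =
      ∑ i ∈ Finset.range n, banachLim (a i) := by
  induction n with
  | zero => simpa using banachLim_const 0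
  | succ n ih => simp only [Finset.sum_range_succ, banachLim_add, ih]

/-- The two Cesàro averages differ by boundary terms of order 1/(n+1); they are added on both sides
to avoid subtraction. -/
theorem banachLim_succ {a : ℕ → ℝ≥0∞} (h : ∀ k, a k ≤ 1) :
    banachLim (fun k => a (k + 1)) = banachLim a := by
  have hz : ∀ b : ℕ → ℝ≥0∞, (∀ n, b n ≤ 1) →
      Tendsto (fun n : ℕ => ((n : ℝ≥0∞) + 1)⁻¹ * b n) (hyperfilter ℕ : Filter ℕ) (nhds 0) := by
    intro b hb
    have h0 : Tendsto (fun n : ℕ => ((n : ℝ≥0∞) + 1)⁻¹) atTop (nhds 0) := by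
      have := (tendsto_add_atTop_iff_nat 1).2 ENNReal.tendsto_inv_nat_nhds_zero
      simpa using this
    refine tendsto_of_tendsto_of_tendsto_of_le_of_le tendsto_const_nhds
      (h0.mono_left Nat.hyperfilter_le_atTop) (fun _ => zero_le) fun n => ?_
    exact mul_le_of_le_one_right' (hb n)
  have h1 := (tendsto_banachLim fun k => a (k + 1)).add (hz (fun _ => a 0) fun _ => h 0)
  have h2 := (tendsto_banachLim a).add (hz (fun n => a (n + 1)) fun n => h (n + 1))
  rw [add_zero] at h1 h2
  refine tendsto_nhds_unique h1 (h2.congr fun n => ?_)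
  simp only [cesaro, ← mul_add]
  rw [← Finset.sum_range_succ, Finset.sum_range_succ' a (n + 1)]

end BanachLimit

/-! ### The largest measure below a finitely additive limit -/

section MaximalMeasure

variable {α : Type*} [MeasurableSpace α]

/-- A superadditive homogeneous functional dominating a measure on indicators dominates its
integral. -/
theorem lintegral_le_of_measure_le {m : Measure α} (L : (α → ℝ≥0∞) → ℝ≥0∞)
    (hmono : ∀ f g : α → ℝ≥0∞, f ≤ g → L f ≤ L g)
    (hadd : ∀ f g : α → ℝ≥0∞, Measurable f → Measurable g → L f + L g ≤ L (f + g))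
    (hmul : ∀ (c : ℝ≥0) (f : α → ℝ≥0∞), Measurable f → (c : ℝ≥0∞) * L f ≤ L fun x => c * f x)
    (h : ∀ A, MeasurableSet A → m A ≤ L (A.indicator 1)) (f : α → ℝ≥0∞) :
    ∫⁻ x, f x ∂m ≤ L f := by
  have key : ∀ φ : SimpleFunc α ℝ≥0, ∫⁻ x, φ x ∂m ≤ L fun x => φ x := by
    intro φ
    induction φ using SimpleFunc.induction with
    | const c hs =>
      rename_i s
      have he : (fun x => ((SimpleFunc.piecewise s hs (SimpleFunc.const α c)
          (SimpleFunc.const α 0)) x : ℝ≥0∞)) = fun x => (c : ℝ≥0∞) * s.indicator 1 x := by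
        funext x
        by_cases hx : x ∈ s <;> simp [hx]
      rw [he, lintegral_const_mul _ (measurable_one.indicator hs), lintegral_indicator_one hs]
      exact le_trans (by gcongr; exact h s hs) (hmul c _ (measurable_one.indicator hs))
    | add hd h1 h2 =>
      rename_i f g
      have hf : Measurable fun x => (f x : ℝ≥0∞) := f.measurable.coe_nnreal_ennreal
      have hg : Measurable fun x => (g x : ℝ≥0∞) := g.measurable.coe_nnreal_ennreal
      have he : (fun x => (((f + g : SimpleFunc α ℝ≥0) x : ℝ≥0) : ℝ≥0∞)) =
          (fun x => (f x : ℝ≥0∞)) + fun x => (g x : ℝ≥0∞) := by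
        funext x; simp
      rw [he]
      calc _ = _ := lintegral_add_left hf _
        _ ≤ _ := add_le_add h1 h2
        _ ≤ _ := hadd _ _ hf hg
  rw [lintegral_eq_nnreal]
  refine iSup₂_le fun φ hφ => ?_
  rw [← SimpleFunc.lintegral_eq_lintegral]
  exact (key φ).trans (hmono _ _ hφ)

/-- The largest measure below the generalized limit of a sequence of measures. -/
theorem exists_maximal_measure (ms : ℕ → Measure α) :
    ∃ m : Measure α, (∀ A, MeasurableSet A → m A ≤ banachLim fun k => ms k A) ∧
      ∀ m' : Measure α, (∀ A, MeasurableSet A → m' A ≤ banachLim fun k => ms k A) → m' ≤ m := by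
  have h0 : (fun A => banachLim fun k => ms k A) (∅ : Set α) = 0 := by
    simpa using banachLim_const 0
  -- The generalized limit splits additively along a measurable set, so such a set is Carathéodory
  -- measurable for the outer measure it generates.
  have hle : ‹MeasurableSpace α› ≤
      (OuterMeasure.ofFunction (fun A => banachLim fun k => ms k A) h0).caratheodory := by
    intro s hs
    refine OuterMeasure.ofFunction_caratheodory fun t => ?_
    rw [← banachLim_add]
    exact banachLim_mono fun k => (measure_inter_add_sdiff t hs).le
  refine ⟨OuterMeasure.toMeasure _ hle, fun A hA => ?_, fun m' hm' => Measure.le_iff.2 fun A hA => ?_⟩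
  · rw [toMeasure_apply _ hle hA]
    exact OuterMeasure.ofFunction_le _
  · rw [toMeasure_apply _ hle hA]
    refine (OuterMeasure.le_ofFunction (μ := m'.toOuterMeasure)).2 (fun s => ?_) A
    -- The coverings use arbitrary sets; a measurable hull common to all `ms k` leaves every value
    -- `ms k s` unchanged.
    have hH : MeasurableSet (⋂ k, toMeasurable (ms k) s) :=
      .iInter fun k => measurableSet_toMeasurable _ _
    calc m' s ≤ m' (⋂ k, toMeasurable (ms k) s) :=
          measure_mono (Set.subset_iInter fun k => subset_toMeasurable _ _)
      _ ≤ _ := hm' _ hH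
      _ ≤ _ := banachLim_mono fun k =>
        (measure_mono (Set.iInter_subset _ k)).trans (measure_toMeasurable s).le

end MaximalMeasure

/-! ### Existence of an invariant measure -/

section Existence

variable {S E : Type*} [MeasurableSpace S] [MeasurableSpace E]

/-- On sets over a slab, the generalized limit of measures with a common marginal is countably
additive. -/
theorem exists_measure_eq_banachLim_prod (ms : ℕ → Measure (S × E)) (ρ : Measure S)
    [IsFiniteMeasure ρ] (hms : ∀ k, (ms k).map Prod.fst = ρ) {B : Set E} (hB : MeasurableSet B) :
    ∃ l : Measure S, ∀ C, MeasurableSet C → l C = banachLim fun k => ms k (C ×ˢ B) := by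
  have hsup : ∀ {B' : Set E}, MeasurableSet B' → ∀ f : ℕ → Set S, (∀ i, MeasurableSet (f i)) →
      Pairwise (Function.onFun Disjoint f) →
      ∑' i, (banachLim fun k => ms k (f i ×ˢ B')) ≤ banachLim fun k => ms k ((⋃ i, f i) ×ˢ B') := by
    intro B' hB' f hf hd
    refine ENNReal.tsum_le_of_sum_range_le fun n => ?_
    rw [← banachLim_sum]
    refine banachLim_mono fun k => ?_
    rw [← measure_biUnion_finset (s := Finset.range n) (f := fun i => f i ×ˢ B')
      (fun i _ j _ hij => (Set.disjoint_prod.2 (Or.inl (hd hij)))) (fun i _ => (hf i).prod hB')]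
    exact measure_mono (Set.iUnion₂_subset fun i _ =>
      Set.prod_mono (Set.subset_iUnion f i) le_rfl)
  have hsum : ∀ C, MeasurableSet C → (banachLim fun k => ms k (C ×ˢ B)) +
      (banachLim fun k => ms k (C ×ˢ Bᶜ)) = ρ C := by
    intro C hC
    rw [← banachLim_add, ← banachLim_const (ρ C)]
    congr 1
    funext k
    rw [← hms k, Measure.map_apply measurable_fst hC,
      ← measure_inter_add_sdiff (Prod.fst ⁻¹' C) (measurable_snd hB)]
    rfl
  refine ⟨Measure.ofMeasurable (fun C _ => banachLim fun k => ms k (C ×ˢ B))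
    (by simpa using banachLim_const 0) ?_, fun C hC => Measure.ofMeasurable_apply C hC⟩
  intro f hf hd
  have h1 := hsup hB f hf hd
  have h2 := hsup hB.compl f hf hd
  have h3 := hsum _ (MeasurableSet.iUnion hf)
  -- The slabs over `B` and `Bᶜ` are both countably superadditive and add up to the finite measure
  -- ρ, which is countably additive; so neither inequality is strict.
  rw [measure_iUnion hd hf, ← tsum_congr fun i => hsum _ (hf i), ENNReal.tsum_add] at h3
  refine le_antisymm ?_ h1
  have hfin : ∑' i, (banachLim fun k => ms k (f i ×ˢ Bᶜ)) ≠ ⊤ := by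
    refine ne_top_of_le_ne_top (measure_ne_top ρ (⋃ i, f i)) (h2.trans ?_)
    rw [← hsum _ (MeasurableSet.iUnion hf)]
    exact le_add_self
  refine (ENNReal.add_le_add_iff_right hfin).1 ?_
  rw [← h3]
  gcongr

variable {θ : S → S} (hθ : Measurable θ) (κ : Kernel (S × E) E) [IsMarkovKernel κ]

/-- The law of the skew chain at time `k`. -/
noncomputable def iterLaw (m₀ : Measure (S × E)) : ℕ → Measure (S × E)
  | 0 => m₀
  | k + 1 => (iterLaw m₀ k).bind (skewKernel hθ κ)

instance (m₀ : Measure (S × E)) [IsProbabilityMeasure m₀] (k : ℕ) :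
    IsProbabilityMeasure (iterLaw hθ κ m₀ k) := by
  induction k with
  | zero => assumption
  | succ k ih => unfold iterLaw; infer_instance

theorem map_fst_bind_skewKernel (m : Measure (S × E)) :
    (m.bind (skewKernel hθ κ)).map Prod.fst = (m.map Prod.fst).map θ := by
  ext C hC
  rw [Measure.map_apply measurable_fst hC, Measure.map_apply hθ hC,
    Measure.map_apply measurable_fst (hθ hC),
    Measure.bind_apply (measurable_fst hC) (Kernel.aemeasurable _),
    ← lintegral_indicator_one (measurable_fst (hθ hC))]
  refine lintegral_congr fun w => ?_
  rw [skewKernel_apply _ _ _ (measurable_fst hC)]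
  by_cases h : θ w.1 ∈ C <;> simp [← Set.preimage_comp, Function.comp_def, h]

theorem map_fst_iterLaw {ρ : Measure S} (hρ : ρ.map θ = ρ) {m₀ : Measure (S × E)}
    (h0 : m₀.map Prod.fst = ρ) (k : ℕ) : (iterLaw hθ κ m₀ k).map Prod.fst = ρ := by
  induction k with
  | zero => exact h0
  | succ k ih => rw [iterLaw, map_fst_bind_skewKernel, ih, hρ]

/-- A tight skew chain with small sets has an invariant probability measure over every invariant
probability measure of the base. -/
theorem exists_invariant {V : E → ℝ≥0} (hV : Measurable V) (hs : HasSmallSets κ V)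
    {ρ : Measure S} [IsProbabilityMeasure ρ] (hρ : ρ.map θ = ρ) {m₀ : Measure (S × E)}
    [IsProbabilityMeasure m₀] (h0 : m₀.map Prod.fst = ρ)
    (htight : ∀ ε : ℝ≥0∞, 0 < ε → ∃ R₀ : ℝ≥0, ∀ k, iterLaw hθ κ m₀ k {w | R₀ < V w.2} ≤ ε) :
    ∃ m : Measure (S × E), IsProbabilityMeasure m ∧ m.bind (skewKernel hθ κ) = m ∧
      m.map Prod.fst = ρ := by
  set T := skewKernel hθ κ
  set ms := iterLaw hθ κ m₀
  obtain ⟨m, hle, hmax⟩ := exists_maximal_measure ms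
  have hone : ∀ k (A : Set (S × E)), ms k A ≤ 1 := fun k A => prob_le_one
  have hmu : m Set.univ ≤ 1 := (hle _ .univ).trans (banachLim_le_const fun k => hone k _)
  have : IsFiniteMeasure m := ⟨hmu.trans_lt ENNReal.one_lt_top⟩
  let L : (S × E → ℝ≥0∞) → ℝ≥0∞ := fun f => banachLim fun k => ∫⁻ w, f w ∂(ms k)
  have hLmono : ∀ f g : S × E → ℝ≥0∞, f ≤ g → L f ≤ L g := fun f g hfg =>
    banachLim_mono fun k => lintegral_mono hfg
  have hLadd : ∀ f g : S × E → ℝ≥0∞, Measurable f → L f + L g = L (f + g) := by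
    intro f g hf
    simp only [L]
    rw [← banachLim_add]
    congr 1
    funext k
    exact (lintegral_add_left hf g).symm
  have hLmul : ∀ (c : ℝ≥0) (f : S × E → ℝ≥0∞), Measurable f →
      (c : ℝ≥0∞) * L f = L fun x => c * f x := by
    intro c f hf
    simp only [L]
    rw [← banachLim_const_mul]
    congr 1
    funext k
    exact (lintegral_const_mul _ hf).symm
  have hLind : ∀ A, MeasurableSet A → L (A.indicator 1) = banachLim fun k => ms k A := by
    intro A hA
    simp only [L, lintegral_indicator_one hA]
  have hLint : ∀ f : S × E → ℝ≥0∞, ∫⁻ w, f w ∂m ≤ L f := fun f =>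
    lintegral_le_of_measure_le L hLmono (fun f g hf _ => (hLadd f g hf).le)
      (fun c f hf => (hLmul c f hf).le) (fun A hA => (hle A hA).trans (hLind A hA).ge) f
  have hLT : ∀ A, MeasurableSet A → L (fun w => T w A) = banachLim fun k => ms k A := by
    intro A hA
    rw [← banachLim_succ fun k => hone k A]
    simp only [L]
    congr 1
    funext k
    exact (Measure.bind_apply hA (Kernel.aemeasurable _)).symm
  have hminv : m.bind T = m := by
    refine bind_eq_of_bind_le (hmax _ fun A hA => ?_)
    rw [Measure.bind_apply hA (Kernel.aemeasurable _), ← hLT A hA]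
    exact hLint _
  have hprob : m Set.univ = 1 := by
    by_contra hne
    have hlt : m Set.univ < 1 := lt_of_le_of_ne hmu hne
    obtain ⟨ε, hε1, hε2⟩ : ∃ ε : ℝ≥0∞, 0 < ε ∧ m Set.univ + ε < 1 := by
      obtain ⟨c, hc1, hc2⟩ := exists_between hlt
      refine ⟨c - m Set.univ, tsub_pos_of_lt hc1, ?_⟩
      rwa [add_tsub_cancel_of_le hc1.le]
    obtain ⟨R₀, hR₀⟩ := htight ε hε1
    set R := max R₀ 1
    obtain ⟨η, hηm, hηpos, ν, hν, hmin⟩ := hs R (lt_of_lt_of_le one_pos (le_max_right _ _))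
    have hB : MeasurableSet {y | V y ≤ R} := measurableSet_le hV measurable_const
    set B := {y | V y ≤ R} with hBdef
    have hB' : MeasurableSet (Prod.snd ⁻¹' B : Set (S × E)) := measurable_snd hB
    set B' : Set (S × E) := Prod.snd ⁻¹' B with hB'def
    obtain ⟨l, hl⟩ := exists_measure_eq_banachLim_prod ms ρ (map_fst_iterLaw hθ κ hρ h0) hB
    set σ := (m.restrict B').map Prod.fst with hσ
    have hprodB : ∀ C : Set S, Prod.fst ⁻¹' C ∩ B' = C ×ˢ B := fun C => by ext w; simp [B']
    have hσl : σ ≤ l := by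
      refine Measure.le_iff.2 fun C hC => ?_
      rw [hσ, Measure.map_apply measurable_fst hC, Measure.restrict_apply (measurable_fst hC),
        hprodB, hl C hC]
      exact hle _ (hC.prod hB)
    have hzσ : l - σ + σ = l := Measure.sub_add_cancel_of_le hσl
    -- The part of the limit over the slab that `m` misses, seen on the base.
    set ζ := l - σ
    let K : Kernel S (S × E) := Kernel.deterministic θ hθ ×ₖ ν
    have hKm : ∀ A, MeasurableSet A → ∀ x, K x A = ν x (Prod.mk (θ x) ⁻¹' A) := by
      intro A hA x
      rw [← lintegral_indicator_one hA, Kernel.lintegral_deterministic_prod _ _ _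
        (measurable_one.indicator hA), ← lintegral_indicator_one (measurable_prodMk_left hA)]
      rfl
    set γ := (ζ.withDensity η).bind K with hγ
    have hγA : ∀ A, MeasurableSet A → γ A = ∫⁻ x, η x * K x A ∂ζ := by
      intro A hA
      rw [hγ, Measure.bind_apply hA (Kernel.aemeasurable _),
        lintegral_withDensity_eq_lintegral_mul _ hηm (Kernel.measurable_coe K hA)]
      rfl
    -- Split T(·, A) into the minorizing part `g` on the slab and a remainder. The remainder is
    -- integrated against `m`, but `g` against the full limit `l` = σ + ζ; the gain is exactly γ.
    have hadd : m + γ ≤ m := by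
      refine hmax _ fun A hA => ?_
      set gA : S → ℝ≥0∞ := fun x => η x * K x A with hgA
      have hgAm : Measurable gA := hηm.mul (Kernel.measurable_coe K hA)
      set g : S × E → ℝ≥0∞ := B'.indicator fun w => gA w.1 with hg
      have hgm : Measurable g := (hgAm.comp measurable_fst).indicator hB'
      have hTm : Measurable fun w => T w A := Kernel.measurable_coe T hA
      have hgT : ∀ w, g w ≤ T w A := by
        intro w
        by_cases hw : w ∈ B'
        · rw [hg, Set.indicator_of_mem hw, hgA, skewKernel_apply hθ κ w hA]
          dsimp only
          rw [hKm A hA]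
          exact hmin w.1 w.2 hw _ (measurable_prodMk_left hA)
        · rw [hg, Set.indicator_of_notMem hw]
          exact zero_le
      have hsplit : (fun w => T w A) = g + fun w => T w A - g w := by
        funext w
        exact (add_tsub_cancel_of_le (hgT w)).symm
      have hLg : ∫⁻ x, gA x ∂l ≤ L g := by
        refine lintegral_le_of_measure_le (m := l)
          (fun f => L (B'.indicator fun w => f w.1)) ?_ ?_ ?_ ?_ gA
        · intro f f' hff
          refine hLmono _ _ fun w => ?_
          by_cases hw : w ∈ B'
          · simpa [hw] using hff w.1
          · simp [hw]
        · intro f f' hf _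
          have hfm : Measurable (B'.indicator fun w => f w.1) :=
            (hf.comp measurable_fst).indicator hB'
          rw [hLadd _ _ hfm]
          refine hLmono _ _ fun w => ?_
          by_cases hw : w ∈ B' <;> simp [hw]
        · intro c f hf
          have hfm : Measurable (B'.indicator fun w => f w.1) :=
            (hf.comp measurable_fst).indicator hB'
          rw [hLmul c _ hfm]
          refine hLmono _ _ fun w => ?_
          by_cases hw : w ∈ B' <;> simp [hw]
        · intro C hC
          rw [hl C hC, ← hLind _ (hC.prod hB)]
          refine hLmono _ _ fun w => ?_
          by_cases h1 : w.1 ∈ C <;> by_cases h2 : w.2 ∈ B <;> simp [B', h1, h2]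
      have hgint : ∫⁻ w, g w ∂m = ∫⁻ x, gA x ∂σ := by
        rw [hσ, lintegral_map hgAm measurable_fst, hg, lintegral_indicator hB']
      calc (m + γ) A = (∫⁻ w, T w A ∂m) + γ A := by
            conv_lhs => rw [← hminv]
            rw [Measure.add_apply, Measure.bind_apply hA (Kernel.aemeasurable _)]
        _ = (∫⁻ w, g w ∂m) + (∫⁻ w, (T w A - g w) ∂m) + γ A := by
            congr 1
            rw [← lintegral_add_left hgm]
            exact lintegral_congr fun w => congrFun hsplit w
        _ = ((∫⁻ x, gA x ∂ζ) + ∫⁻ x, gA x ∂σ) + ∫⁻ w, (T w A - g w) ∂m := by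
            rw [hgint, hγA A hA]; ring
        _ = (∫⁻ x, gA x ∂l) + ∫⁻ w, (T w A - g w) ∂m := by
            rw [← lintegral_add_measure, hzσ]
        _ ≤ L g + L fun w => T w A - g w := add_le_add hLg (hLint _)
        _ = L fun w => T w A := by rw [hLadd _ _ hgm, ← hsplit]
        _ = _ := hLT A hA
    have hγ0 : γ Set.univ = 0 := by
      have := hadd Set.univ
      rw [Measure.add_apply] at this
      exact le_zero_iff.1 ((ENNReal.add_le_add_iff_left (measure_ne_top m Set.univ)).1
        (by rwa [add_zero]))
    have hζ0 : ζ = 0 := by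
      rw [hγA _ .univ] at hγ0
      have hpos : ∀ x, η x * K x Set.univ = η x := fun x => by
        rw [hKm _ .univ, Set.preimage_univ, measure_univ, mul_one]
      simp only [hpos] at hγ0
      rw [lintegral_eq_zero_iff hηm] at hγ0
      rw [← Measure.measure_univ_eq_zero]
      refine measure_mono_null (fun x _ => ?_) hγ0
      exact (hηpos x).ne'
    rw [hζ0, zero_add] at hzσ
    have h1 : l Set.univ ≤ m Set.univ := by
      rw [← hzσ, hσ, Measure.map_apply measurable_fst .univ, Set.preimage_univ]
      exact Measure.restrict_apply_le _ _
    have h2 : 1 ≤ l Set.univ + ε := by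
      rw [hl _ .univ, ← banachLim_const 1, ← banachLim_const ε, ← banachLim_add]
      refine banachLim_mono fun k => ?_
      rw [← measure_univ (μ := ms k), ← measure_add_measure_compl (μ := ms k) hB',
        ← hprodB, Set.preimage_univ, Set.univ_inter]
      refine add_le_add le_rfl ((measure_mono fun w hw => ?_).trans (hR₀ k))
      have : ¬ V w.2 ≤ R := hw
      exact lt_of_le_of_lt (le_max_left _ _) (not_le.1 this)
    exact absurd (h2.trans (add_le_add h1 le_rfl)) (not_le.2 hε2)
  refine ⟨m, ⟨hprob⟩, hminv, ?_⟩
  have : IsProbabilityMeasure m := ⟨hprob⟩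
  have : IsProbabilityMeasure (m.map Prod.fst) := Measure.isProbabilityMeasure_map (by fun_prop)
  -- All laws of the sequence have marginal ρ, so that of `m` is at most ρ, and both have mass one.
  refine Measure.eq_of_le_of_isProbabilityMeasure (Measure.le_iff.2 fun C hC => ?_)
  rw [Measure.map_apply measurable_fst hC]
  refine (hle _ (measurable_fst hC)).trans (banachLim_le_const fun k => ?_)
  rw [← Measure.map_apply measurable_fst hC, map_fst_iterLaw hθ κ hρ h0]

end Existence


/-! ### Tightness from the drift condition -/

section Tightness

variable {S E : Type*} [MeasurableSpace S] [MeasurableSpace E]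
  {θ : S → S} (hθ : Measurable θ) (κ : Kernel (S × E) E) [IsMarkovKernel κ]

/-- The quenched drift bound, integrated against a function of the environment. -/
theorem lintegral_iterLaw_le {V : E → ℝ≥0} (hV : Measurable V) {lam b : S → ℝ≥0∞}
    (hlam : Measurable lam) (hb : Measurable b)
    (hdrift : ∀ w, ∫⁻ y, (V y : ℝ≥0∞) ∂(κ w) ≤ lam w.1 * V w.2 + b w.1)
    {ρ : Measure S} (hρ : ρ.map θ = ρ) {y₀ : E} {D : ℕ → S → ℝ≥0∞} (hDm : ∀ n, Measurable (D n))
    (hD0 : ∀ x, D 0 x = V y₀) (hD1 : ∀ n x, D (n + 1) (θ x) = lam x * D n x + b x)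
    (n : ℕ) {g : S → ℝ≥0∞} (hg : Measurable g) :
    ∫⁻ w, g w.1 * V w.2 ∂(iterLaw hθ κ (ρ.map fun x => (x, y₀)) n) ≤ ∫⁻ x, g x * D n x ∂ρ := by
  have hVm : Measurable fun y => (V y : ℝ≥0∞) := hV.coe_nnreal_ennreal
  have hgV : ∀ {g : S → ℝ≥0∞}, Measurable g → Measurable fun w : S × E => g w.1 * V w.2 :=
    fun hg => (hg.comp measurable_fst).mul (hVm.comp measurable_snd)
  have hmarg := map_fst_iterLaw hθ κ hρ (m₀ := ρ.map fun x => (x, y₀))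
    (by rw [Measure.map_map measurable_fst (by fun_prop)]; exact Measure.map_id)
  -- The weight must vary: the step uses the bound at time n with the weight (g ∘ θ) · lam.
  induction n generalizing g with
  | zero =>
    rw [iterLaw, lintegral_map (hgV hg) (by fun_prop)]
    exact lintegral_mono fun x => by rw [hD0]
  | succ n ih =>
    rw [iterLaw, Measure.lintegral_bind (Kernel.aemeasurable _) (hgV hg).aemeasurable]
    calc _ ≤ ∫⁻ w, (g (θ w.1) * lam w.1 * V w.2 + g (θ w.1) * b w.1) ∂(iterLaw hθ κ _ n) := by
          refine lintegral_mono fun w => ?_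
          rw [lintegral_skewKernel hθ κ w (hgV hg)]
          dsimp only
          rw [lintegral_const_mul _ hVm, mul_assoc, ← mul_add]
          gcongr
          exact hdrift w
      _ = (∫⁻ w, g (θ w.1) * lam w.1 * V w.2 ∂(iterLaw hθ κ _ n)) +
            ∫⁻ w, g (θ w.1) * b w.1 ∂(iterLaw hθ κ _ n) :=
          lintegral_add_left (hgV ((hg.comp hθ).mul hlam)) _
      _ ≤ (∫⁻ x, g (θ x) * lam x * D n x ∂ρ) + ∫⁻ x, g (θ x) * b x ∂ρ := by
          refine add_le_add (ih ((hg.comp hθ).mul hlam)) (le_of_eq ?_)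
          conv_rhs => rw [← hmarg n]
          rw [lintegral_map (by fun_prop) measurable_fst]
      _ = ∫⁻ x, g (θ x) * D (n + 1) (θ x) ∂ρ := by
          have := hDm n
          rw [← lintegral_add_left (by fun_prop)]
          refine lintegral_congr fun x => ?_
          rw [hD1]; ring
      _ = ∫⁻ x, g x * D (n + 1) x ∂ρ := by
          have := hDm (n + 1)
          conv_rhs => rw [← hρ]
          rw [lintegral_map (by fun_prop) hθ]

/-- The laws of the skew chain are tight when the iterated drift bounds are almost surely
bounded. -/
theorem tight_iterLaw {V : E → ℝ≥0} (hV : Measurable V) {lam b : S → ℝ≥0∞}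
    (hlam : Measurable lam) (hb : Measurable b)
    (hdrift : ∀ w, ∫⁻ y, (V y : ℝ≥0∞) ∂(κ w) ≤ lam w.1 * V w.2 + b w.1)
    {ρ : Measure S} [IsProbabilityMeasure ρ] (hρ : ρ.map θ = ρ) {y₀ : E} {D : ℕ → S → ℝ≥0∞}
    (hDm : ∀ n, Measurable (D n))
    (hD0 : ∀ x, D 0 x = V y₀) (hD1 : ∀ n x, D (n + 1) (θ x) = lam x * D n x + b x)
    (hfin : ∀ᵐ x ∂ρ, ⨆ n, D n x < ⊤) {ε : ℝ≥0∞} (hε : 0 < ε) :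
    ∃ R₀ : ℝ≥0, ∀ k, iterLaw hθ κ (ρ.map fun x => (x, y₀)) k {w | R₀ < V w.2} ≤ ε := by
  have hDs : Measurable fun x => ⨆ n, D n x := .iSup hDm
  obtain ⟨c, hc0, hcε⟩ := ENNReal.lt_iff_exists_nnreal_btwn.1 hε
  rw [ENNReal.coe_pos] at hc0
  obtain ⟨M, hM⟩ := exists_measure_superlevel_lt ρ hDs.ennreal_toNNReal
    (ε := ε - c) (tsub_pos_of_lt hcε)
  have hMρ : ρ {x | (M : ℝ≥0∞) < ⨆ n, D n x} ≤ ε - c := by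
    refine le_trans (measure_mono_ae ?_) (hM M le_rfl).le
    filter_upwards [hfin] with x hx h
    have h' : (M : ℝ≥0∞) < ⨆ n, D n x := h
    change M < (⨆ n, D n x).toNNReal
    rwa [← ENNReal.coe_lt_coe, ENNReal.coe_toNNReal hx.ne]
  have hmarg := map_fst_iterLaw hθ κ hρ (m₀ := ρ.map fun x => (x, y₀))
    (by rw [Measure.map_map measurable_fst (by fun_prop)]; exact Measure.map_id)
  set A : Set S := {x | ⨆ n, D n x ≤ M} with hA
  have hAm : MeasurableSet A := measurableSet_le hDs measurable_const
  -- Bad environments cost ε - c. On the good ones Markov's inequality costs at most c, since R₀ c ≥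
  -- M; the summand 1 keeps R₀ nonzero for the division.
  refine ⟨M / c + 1, fun k => ?_⟩
  set mk := iterLaw hθ κ (ρ.map fun x => (x, y₀)) k
  set R₀ : ℝ≥0 := M / c + 1
  have hVm : Measurable fun w : S × E => (V w.2 : ℝ≥0∞) :=
    (hV.comp measurable_snd).coe_nnreal_ennreal
  have hgm : Measurable (A.indicator (1 : S → ℝ≥0∞)) := measurable_one.indicator hAm
  have h1 : mk {w | w.1 ∉ A} ≤ ε - c := by
    refine le_trans (le_of_eq ?_) hMρ
    rw [← hmarg k, Measure.map_apply measurable_fst (measurableSet_lt measurable_const hDs)]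
    congr 1
    ext w
    exact not_le (a := ⨆ n, D n w.1) (b := (M : ℝ≥0∞))
  have h2 : mk {w | (R₀ : ℝ≥0∞) ≤ A.indicator 1 w.1 * V w.2} ≤ c := by
    have hmk := mul_meas_ge_le_lintegral (μ := mk) ((hgm.comp measurable_fst).mul hVm) (R₀ : ℝ≥0∞)
    have hle := lintegral_iterLaw_le hθ κ hV hlam hb hdrift hρ hDm hD0 hD1 k hgm
    have hM' : ∫⁻ x, A.indicator 1 x * D k x ∂ρ ≤ M := by
      calc _ ≤ ∫⁻ _, (M : ℝ≥0∞) ∂ρ := by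
            refine lintegral_mono fun x => ?_
            by_cases hx : x ∈ A
            · simpa [hx] using (le_iSup (fun n => D n x) k).trans hx
            · simp [hx]
        _ = M := by simp
    have hR : (M : ℝ≥0∞) ≤ R₀ * c := by
      rw [← ENNReal.coe_mul, ENNReal.coe_le_coe]
      simp only [R₀]
      rw [add_mul, div_mul_cancel₀ _ hc0.ne']
      exact le_self_add
    have hfinal := (hmk.trans hle).trans (hM'.trans hR)
    refine (ENNReal.mul_le_mul_iff_right (a := (R₀ : ℝ≥0∞)) ?_ ENNReal.coe_ne_top).1 hfinal
    simp [R₀]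
  calc mk {w | R₀ < V w.2} ≤
        mk ({w | w.1 ∉ A} ∪ {w | (R₀ : ℝ≥0∞) ≤ A.indicator 1 w.1 * V w.2}) := by
        refine measure_mono fun w hw => ?_
        by_cases hwA : w.1 ∈ A
        · refine Or.inr ?_
          rw [Set.mem_ofPred_eq] at hw ⊢
          simpa [hwA] using hw.le
        · exact Or.inl hwA
    _ ≤ _ := measure_union_le _ _
    _ ≤ (ε - c) + c := add_le_add h1 h2
    _ = ε := tsub_add_cancel_of_le hcε.le

end Tightness

/-! ### Almost sure boundedness of the drift bounds -/

section Growth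

theorem le_exp_posLog (c : ℝ) : c ≤ Real.exp (Real.posLog c) := by
  rcases le_or_gt c 0 with h | h
  · exact h.trans (Real.exp_pos _).le
  · calc c = Real.exp (Real.log c) := (Real.exp_log h).symm
      _ ≤ _ := Real.exp_le_exp.2 (le_max_right _ _)

/-- Products with root limit superior below one, weighted by a subexponential sequence, have
bounded sums. -/
theorem iSup_prod_add_sum_lt_top {l c : ℕ → ℝ≥0} (v : ℝ≥0)
    (hl : limsup (fun n : ℕ => (∏ i ∈ Finset.range n, (l i : ℝ≥0∞)) ^ (1 / (n : ℝ))) atTop < 1)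
    (hc : ∀ ε : ℝ, 0 < ε → ∀ᶠ k : ℕ in atTop, Real.posLog (c k) ≤ ε * k) :
    ⨆ n : ℕ, ((∏ i ∈ Finset.range n, (l i : ℝ≥0∞)) * v +
      ∑ k ∈ Finset.range n, (∏ i ∈ Finset.range k, (l i : ℝ≥0∞)) * c k) < ⊤ := by
  obtain ⟨q, hq0, hq1⟩ := ENNReal.lt_iff_exists_nnreal_btwn.1 hl
  have hqpos : 0 < q := ENNReal.coe_pos.1 (lt_of_le_of_lt zero_le hq0)
  have hq1' : q < 1 := by exact_mod_cast hq1
  have hprod : ∀ᶠ n : ℕ in atTop, ∏ i ∈ Finset.range n, l i ≤ q ^ n := by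
    filter_upwards [eventually_lt_of_limsup_lt hq0, eventually_ge_atTop 1] with n hn hn1
    have hn0 : (n : ℝ) ≠ 0 := by positivity
    have h := ENNReal.rpow_le_rpow hn.le (Nat.cast_nonneg (α := ℝ) n)
    rw [← ENNReal.rpow_mul, one_div, inv_mul_cancel₀ hn0, ENNReal.rpow_one,
      ENNReal.rpow_natCast] at h
    exact_mod_cast h
  obtain ⟨P, hP⟩ : ∃ P, ∀ n, ∏ i ∈ Finset.range n, l i ≤ P := by
    have hb : IsBoundedUnder (· ≤ ·) atTop fun n => ∏ i ∈ Finset.range n, l i :=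
      ⟨1, eventually_map.2 (hprod.mono fun n hn => hn.trans (pow_le_one₀ zero_le hq1'.le))⟩
    obtain ⟨P, hP⟩ := hb.bddAbove_range
    exact ⟨P, fun n => hP ⟨n, rfl⟩⟩
  -- Half the decay rate of q^k absorbs the growth of c: q^k exp(εk) = exp(-εk).
  set ε : ℝ := - Real.log q / 2
  have hε : 0 < ε := by
    have : Real.log q < 0 := Real.log_neg hqpos hq1'
    simp only [ε]; linarith
  set r : ℝ := Real.exp (-ε)
  have hsum : Summable fun k => (∏ i ∈ Finset.range k, l i) * c k := by
    rw [← NNReal.summable_coe]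
    have hr : Summable fun k : ℕ => r ^ k :=
      summable_geometric_of_lt_one (Real.exp_pos _).le (Real.exp_lt_one_iff.2 (by linarith))
    refine Summable.of_norm_bounded_eventually_nat hr ?_
    filter_upwards [hprod, hc ε hε] with k hk hck
    rw [Real.norm_of_nonneg (NNReal.coe_nonneg _), NNReal.coe_mul]
    have h1 : ((∏ i ∈ Finset.range k, l i : ℝ≥0) : ℝ) ≤ (q : ℝ) ^ k := by exact_mod_cast hk
    have h2 : (c k : ℝ) ≤ Real.exp (ε * k) := (le_exp_posLog _).trans (Real.exp_le_exp.2 hck)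
    have h3 : (q : ℝ) = Real.exp (-(2 * ε)) := by
      have : -(2 * ε) = Real.log q := by simp only [ε]; ring
      rw [this, Real.exp_log (by exact_mod_cast hqpos)]
    calc _ ≤ (q : ℝ) ^ k * Real.exp (ε * k) := by gcongr
      _ = r ^ k := by
        rw [h3, ← Real.exp_nat_mul, ← Real.exp_nat_mul, ← Real.exp_add]
        congr 1; ring
  refine lt_of_le_of_lt (iSup_le fun n => ?_)
    (ENNReal.coe_lt_top (r := P * v + ∑' k, (∏ i ∈ Finset.range k, l i) * c k))
  have : (∏ i ∈ Finset.range n, l i) * v +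
      ∑ k ∈ Finset.range n, (∏ i ∈ Finset.range k, l i) * c k ≤
      P * v + ∑' k, (∏ i ∈ Finset.range k, l i) * c k := by
    gcongr
    · exact hP n
    · exact hsum.sum_le_tsum _ fun _ _ => zero_le
  exact_mod_cast this

variable {Ω F : Type*} [MeasurableSpace Ω] [MeasurableSpace F]

theorem map_eq_map_zero {μ : Measure Ω} {X : ℤ → Ω → F} (hX : IsStationaryProcess μ X) (t : ℤ) :
    μ.map (X t) = μ.map (X 0) := by
  have h := congrArg (fun m : Measure (ℤ → F) => m.map fun z => z 0) (hX.translate t)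
  simp only [pathLaw] at h
  rw [Measure.map_map (measurable_pi_apply 0) (measurable_pi_lambda _ fun s => hX.measurable _),
    Measure.map_map (measurable_pi_apply 0) (measurable_pi_lambda _ fun s => hX.measurable _)] at h
  simpa [Function.comp_def] using h

/-- Along a stationary process, a function with a logarithmic moment grows subexponentially. -/
theorem ae_eventually_posLog_le {μ : Measure Ω} [IsProbabilityMeasure μ] {X : ℤ → Ω → F}
    (hX : IsStationaryProcess μ X) {γ : F → ℝ≥0} (hγ : HasLogMoment μ X γ) :
    ∀ᵐ ω ∂μ, ∀ ε : ℝ, 0 < ε →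
      ∀ᶠ k : ℕ in atTop, Real.posLog (γ (X (-(k : ℤ) - 1) ω)) ≤ ε * k := by
  have hone : ∀ ε : ℝ, 0 < ε → ∀ᵐ ω ∂μ,
      ∀ᶠ k : ℕ in atTop, Real.posLog (γ (X (-(k : ℤ) - 1) ω)) ≤ ε * k := by
    intro ε hε
    have hm : Measurable fun x => Real.posLog (γ x) / ε := by
      have := hγ.measurable
      unfold Real.posLog
      fun_prop
    -- Integrability makes the tail probabilities at `X 0` summable; stationarity moves them to
    -- X_{-k-1}, and Borel–Cantelli applies.
    have ht := @tsum_prob_mem_Ioi_lt_top Ω ⟨μ⟩ ‹_› _ (hγ.integrable.div_const ε)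
      fun ω => div_nonneg Real.posLog_nonneg hε.le
    have hk : ∀ k : ℕ, μ {ω | Real.posLog (γ (X (-(k : ℤ) - 1) ω)) / ε ∈ Set.Ioi (k : ℝ)} =
        μ {ω | Real.posLog (γ (X 0 ω)) / ε ∈ Set.Ioi (k : ℝ)} := by
      intro k
      have h := congrArg (fun m : Measure F => m {x | Real.posLog (γ x) / ε ∈ Set.Ioi (k : ℝ)})
        (map_eq_map_zero hX (-(k : ℤ) - 1))
      have hms : MeasurableSet {x | Real.posLog (γ x) / ε ∈ Set.Ioi (k : ℝ)} :=
        hm measurableSet_Ioi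
      rwa [Measure.map_apply (hX.measurable _) hms, Measure.map_apply (hX.measurable _) hms] at h
    have := ae_eventually_notMem (μ := μ)
      (s := fun k : ℕ => {ω | Real.posLog (γ (X (-(k : ℤ) - 1) ω)) / ε ∈ Set.Ioi (k : ℝ)})
      (by simp only [hk]; exact ht.ne)
    filter_upwards [this] with ω hω
    filter_upwards [hω] with k hk
    rw [Set.mem_Ioi, not_lt, div_le_iff₀ hε, mul_comm] at hk
    exact hk
  -- Countably many rates 1/(j+1) give an exceptional set independent of ε.
  have hall : ∀ᵐ ω ∂μ, ∀ j : ℕ, ∀ᶠ k : ℕ in atTop,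
      Real.posLog (γ (X (-(k : ℤ) - 1) ω)) ≤ 1 / ((j : ℝ) + 1) * k :=
    ae_all_iff.2 fun j => hone _ Nat.one_div_pos_of_nat
  filter_upwards [hall] with ω hω ε hε
  obtain ⟨j, hj⟩ := exists_nat_one_div_lt hε
  filter_upwards [hω j] with k hk
  exact hk.trans (by gcongr)

/-- The iterated drift bound after `n` steps, as a function of the environment. -/
noncomputable def driftBound (lam b : F → ℝ≥0) (v : ℝ≥0) (n : ℕ) (x : ℤ → F) : ℝ≥0∞ :=
  (∏ i ∈ Finset.range n, (lam (x (-(i : ℤ) - 1)) : ℝ≥0∞)) * v +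
    ∑ k ∈ Finset.range n, (∏ i ∈ Finset.range k, (lam (x (-(i : ℤ) - 1)) : ℝ≥0∞)) *
      b (x (-(k : ℤ) - 1))

theorem measurable_driftBound {lam b : F → ℝ≥0} (hlam : Measurable lam) (hb : Measurable b)
    (v : ℝ≥0) (n : ℕ) : Measurable (driftBound lam b v n) := by
  unfold driftBound
  fun_prop

/-- `shift x` at index -1 is `x 0`: one step multiplies every product by the newest factor `lam (x
0)`, and `b (x 0)` enters as the term k = 0. -/
theorem driftBound_succ_shift {F : Type*} (lam b : F → ℝ≥0) (v : ℝ≥0) (n : ℕ) (x : ℤ → F) :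
    driftBound lam b v (n + 1) (shift x) =
      lam (x 0) * driftBound lam b v n x + b (x 0) := by
  have hs : ∀ i : ℕ, shift x (-(i : ℤ) - 1) = x (-(i : ℤ)) := fun i => by simp [shift]
  have hi : ∀ i : ℕ, x (-((i + 1 : ℕ) : ℤ)) = x (-(i : ℤ) - 1) := fun i => by
    congr 1; push_cast; ring
  unfold driftBound
  simp only [hs]
  rw [Finset.prod_range_succ', Finset.sum_range_succ']
  simp only [Finset.prod_range_succ', hi]
  simp only [Nat.cast_zero, neg_zero, Finset.range_zero, Finset.prod_empty, one_mul, mul_add,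
    Finset.mul_sum]
  rw [add_assoc]
  congr 1
  · ring
  · congr 1
    exact Finset.sum_congr rfl fun k _ => by ring

theorem ae_iSup_driftBound_lt_top {E : Type*} [MeasurableSpace E] {μ : Measure Ω}
    [IsProbabilityMeasure μ] {P : Kernel (F × E) E} {X : ℤ → Ω → F}
    (hX : IsStationaryProcess μ X) {V : E → ℝ≥0} {lam b : F → ℝ≥0}
    (hV : DriftCondition P μ X V lam b) (v : ℝ≥0) :
    ∀ᵐ x ∂(pathLaw μ X), ⨆ n, driftBound lam b v n x < ⊤ := by
  have hm : Measurable fun x : ℤ → F => ⨆ n, driftBound lam b v n x :=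
    .iSup fun n => measurable_driftBound hV.logMoment_lam.measurable hV.logMoment_b.measurable v n
  rw [pathLaw, ae_map_iff (measurable_pi_lambda _ hX.measurable).aemeasurable
    (measurableSet_lt hm measurable_const)]
  filter_upwards [hV.contraction, ae_eventually_posLog_le hX hV.logMoment_b] with ω h1 h2
  refine iSup_prod_add_sum_lt_top (l := fun i => lam (X (-(i : ℤ) - 1) ω))
    (c := fun k => b (X (-(k : ℤ) - 1) ω)) v ?_ h2
  have he : ∀ n : ℕ, ∏ i ∈ Finset.Icc 1 n, (lam (X (-(i : ℤ)) ω) : ℝ≥0∞) =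
      ∏ i ∈ Finset.range n, (lam (X (-(i : ℤ) - 1) ω) : ℝ≥0∞) := by
    intro n
    induction n with
    | zero => simp
    | succ n ih =>
      rw [Finset.prod_Icc_succ_top (by lia), ih, Finset.prod_range_succ]
      congr 4
      push_cast; ring
  simpa only [he] using h1

end Growth


/-! ### Sequences with a prepended letter -/

section Cons

/-- Prepend an element to a sequence. -/
def consSeq {E : Type*} (y : E) (p : ℕ → E) : ℕ → E
  | 0 => y
  | n + 1 => p n

@[simp] theorem consSeq_zero {E : Type*} (y : E) (p : ℕ → E) : consSeq y p 0 = y := rfl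

@[simp] theorem consSeq_succ {E : Type*} (y : E) (p : ℕ → E) (n : ℕ) :
    consSeq y p (n + 1) = p n := rfl

@[fun_prop]
theorem measurable_consSeq {α E : Type*} [MeasurableSpace α] [MeasurableSpace E] {f : α → E}
    {g : α → ℕ → E} (hf : Measurable f) (hg : Measurable g) :
    Measurable fun a => consSeq (f a) (g a) := by
  refine measurable_pi_lambda _ fun n => ?_
  cases n with
  | zero => exact hf
  | succ n => exact (measurable_pi_apply n).comp hg

/-- The law of an i.i.d. sequence is the product of the law of its head and that of its tail. -/
theorem map_consSeq_prod_infinitePi {I : Type*} [MeasurableSpace I] (v : Measure I)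
    [IsProbabilityMeasure v] :
    (v.prod (Measure.infinitePi fun _ : ℕ => v)).map (fun u => consSeq u.1 u.2) =
      Measure.infinitePi fun _ : ℕ => v := by
  classical
  refine Measure.eq_infinitePi _ fun s t ht => ?_
  -- Filling with `univ` turns the box over `s` into one over an initial segment, where the head
  -- splits off.
  set t' : ℕ → Set I := fun i => if i ∈ s then t i else Set.univ with ht'
  have ht'm : ∀ i, MeasurableSet (t' i) := fun i => by
    by_cases h : i ∈ s <;> simp [ht', h, ht]
  set N := s.sup id
  have hsN : s ⊆ Finset.range (N + 1) := fun i hi =>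
    Finset.mem_range.2 (Nat.lt_succ_of_le (Finset.le_sup (f := id) hi))
  have hpi : (fun u : I × (ℕ → I) => consSeq u.1 u.2) ⁻¹' Set.pi s t =
      t' 0 ×ˢ Set.pi (Finset.range N) fun i => t' (i + 1) := by
    ext u
    simp only [Set.mem_preimage, Set.mem_pi, Finset.mem_coe, Set.mem_prod, ht', Finset.mem_range]
    constructor
    · intro h
      refine ⟨?_, fun i _ => ?_⟩
      · by_cases h0 : 0 ∈ s
        · simpa [h0] using h 0 h0
        · simp [h0]
      · by_cases h0 : i + 1 ∈ s
        · simpa [h0] using h (i + 1) h0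
        · simp [h0]
    · rintro ⟨h1, h2⟩ i hi
      cases i with
      | zero => simpa [hi] using h1
      | succ i =>
        have := Finset.mem_range.1 (hsN hi)
        simpa [hi] using h2 i (by lia)
  rw [Measure.map_apply (by fun_prop) (MeasurableSet.pi s.countable_toSet fun i _ => ht i), hpi,
    Measure.prod_prod, Measure.infinitePi_pi (fun _ : ℕ => v) fun i _ => ht'm (i + 1)]
  have hprod : ∏ i ∈ s, v (t i) = ∏ i ∈ Finset.range (N + 1), v (t' i) := by
    rw [← Finset.prod_subset hsN fun i _ hi => by simp [ht', hi]]
    exact Finset.prod_congr rfl fun i hi => by simp [ht', hi]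
  rw [hprod, Finset.prod_range_succ', mul_comm]

end Cons

/-! ### Trajectories driven by independent noise -/

section Trajectory

variable {S E : Type*} [MeasurableSpace S] [MeasurableSpace E]

/-- The trajectory driven by the noise `u` of a system moving the environment by `τ`. -/
def noiseTraj {S E I : Type*} (τ : S → S) (f : S × E → I → E) : ℕ → S × E → (ℕ → I) → E
  | 0, w, _ => w.2
  | n + 1, w, u => noiseTraj τ f n (τ w.1, f w (u 0)) fun k => u (k + 1)

theorem measurable_noiseTraj {I : Type*} [MeasurableSpace I] {τ : S → S} (hτ : Measurable τ)
    {f : S × E → I → E} (hf : Measurable (Function.uncurry f)) (n : ℕ) :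
    Measurable fun a : (S × E) × (ℕ → I) => noiseTraj τ f n a.1 a.2 := by
  induction n with
  | zero => exact measurable_snd.comp measurable_fst
  | succ n ih =>
    have h : Measurable fun a : (S × E) × (ℕ → I) =>
        (((τ a.1.1, f a.1 (a.2 0)), fun k => a.2 (k + 1)) : (S × E) × (ℕ → I)) := by
      have h1 : Measurable fun a : (S × E) × (ℕ → I) => f a.1 (a.2 0) :=
        hf.comp (by fun_prop : Measurable fun a : (S × E) × (ℕ → I) => (a.1, a.2 0))
      fun_prop
    exact ih.comp h

/-- The kernel of trajectories of a Markov chain in the environment moved by `τ`: it satisfies the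
one-step decomposition at its first transition. -/
theorem exists_trajectory_kernel [StandardBorelSpace E] [Nonempty E] {τ : S → S}
    (hτ : Measurable τ) (κ : Kernel (S × E) E) [IsMarkovKernel κ] :
    ∃ T : Kernel (S × E) (ℕ → E), IsMarkovKernel T ∧ ∀ w (G : (ℕ → E) → ℝ≥0∞), Measurable G →
      ∫⁻ p, G p ∂(T w) = ∫⁻ z, ∫⁻ p, G (consSeq w.2 p) ∂(T (τ w.1, z)) ∂(κ w) := by
  -- Each transition is a measurable function of the state and a uniform variable, so an i.i.d.
  -- uniform sequence drives the whole trajectory.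
  obtain ⟨f, hf, hκ⟩ := Kernel.exists_measurable_map_eq_unitInterval κ
  let noise : Measure (ℕ → unitInterval) := Measure.infinitePi fun _ => volume
  let g : (S × E) × (ℕ → unitInterval) → ℕ → E := fun a n => noiseTraj τ f n a.1 a.2
  have hg : Measurable g := measurable_pi_lambda _ fun n => measurable_noiseTraj hτ hf n
  let T : Kernel (S × E) (ℕ → E) := (Kernel.id ×ₖ Kernel.const (S × E) noise).map g
  have hT : ∀ w (G : (ℕ → E) → ℝ≥0∞), Measurable G →
      ∫⁻ p, G p ∂(T w) = ∫⁻ u, G (g (w, u)) ∂noise := by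
    intro w G hG
    rw [Kernel.lintegral_map _ hg _ hG,
      Kernel.lintegral_id_prod (f := fun a => G (g a)) (by fun_prop), Kernel.const_apply]
  refine ⟨T, Kernel.IsMarkovKernel.map _ hg, fun w G hG => ?_⟩
  have hcons : ∀ u : unitInterval × (ℕ → unitInterval),
      g (w, consSeq u.1 u.2) = consSeq w.2 (g ((τ w.1, f w u.1), u.2)) := by
    intro u
    funext n
    cases n <;> rfl
  have hGm : ∀ y : E, Measurable fun p : ℕ → E => G (consSeq y p) := fun y => by fun_prop
  have hfw : Measurable (f w) := hf.comp (by fun_prop : Measurable fun u => (w, u))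
  have hmeas : Measurable fun z : E => ∫⁻ p, G (consSeq w.2 p) ∂(T (τ w.1, z)) :=
    ((hGm w.2).lintegral_kernel (κ := T)).comp (by fun_prop : Measurable fun z : E => (τ w.1, z))
  rw [hT w G hG, ← hκ w, lintegral_map hmeas hfw]
  simp only [hT _ _ (hGm w.2)]
  conv_lhs => rw [show noise = _ from (map_consSeq_prod_infinitePi volume).symm]
  rw [lintegral_map (by fun_prop) (by fun_prop)]
  simp only [hcons]
  rw [lintegral_prod _ (by fun_prop)]

variable {T : Kernel (S × E) (ℕ → E)} {κ : Kernel (S × E) E} {τ : S → S}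

/-- A trajectory starts at its initial state. -/
theorem lintegral_trajectory_head
    (hT : ∀ w (G : (ℕ → E) → ℝ≥0∞), Measurable G →
      ∫⁻ p, G p ∂(T w) = ∫⁻ z, ∫⁻ p, G (consSeq w.2 p) ∂(T (τ w.1, z)) ∂(κ w))
    (w : S × E) {H : E × (ℕ → E) → ℝ≥0∞} (hH : Measurable H) :
    ∫⁻ p, H (p 0, p) ∂(T w) = ∫⁻ p, H (w.2, p) ∂(T w) := by
  rw [hT w _ (by fun_prop), hT w _ (by fun_prop)]
  rfl

end Trajectory

/-! ### Extension to the past -/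

section Past

variable {S E : Type*} [MeasurableSpace S] [MeasurableSpace E]

/-- The kernel which appends one transition of the chain to its past, seen from the present. -/
noncomputable def pastKernel (θ : S → S) (κ : Kernel (S × E) E) :
    Kernel (S × (ℕ → E)) (S × (ℕ → E)) :=
  (Kernel.id ×ₖ κ.comap (fun p : S × (ℕ → E) => (p.1, p.2 0)) (by fun_prop)).map
    fun a => (θ a.1.1, consSeq a.2 a.1.2)

theorem lintegral_pastKernel {θ : S → S} (hθ : Measurable θ) (κ : Kernel (S × E) E)
    [IsMarkovKernel κ] (p : S × (ℕ → E)) {G : S × (ℕ → E) → ℝ≥0∞} (hG : Measurable G) :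
    ∫⁻ a, G a ∂(pastKernel θ κ p) = ∫⁻ z, G (θ p.1, consSeq z p.2) ∂(κ (p.1, p.2 0)) := by
  rw [pastKernel, Kernel.lintegral_map _ (by fun_prop) _ hG,
    Kernel.lintegral_id_prod
      (f := fun a : (S × (ℕ → E)) × E => G (θ a.1.1, consSeq a.2 a.1.2)) (by fun_prop),
    Kernel.comap_apply]

/-- Every invariant law of the skew chain is the present of an invariant law of pasts. -/
theorem exists_invariant_past [StandardBorelSpace E] [Nonempty E] (θ : S ≃ᵐ S)
    (κ : Kernel (S × E) E) [IsMarkovKernel κ] {m : Measure (S × E)} [IsProbabilityMeasure m]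
    (hm : m.bind (skewKernel θ.measurable κ) = m) :
    ∃ Λ : Measure (S × (ℕ → E)), IsProbabilityMeasure Λ ∧
      Λ.bind (pastKernel θ κ) = Λ ∧ Λ.map (fun p => (p.1, p.2 0)) = m := by
  -- Joint law of the new state and the previous letter: its first marginal is `m` by invariance,
  -- and its conditional kernel is the backward transition, run along the inverse of θ.
  let M : Measure ((S × E) × E) := (m ⊗ₘ κ).map fun a => ((θ a.1.1, a.2), a.1.2)
  have hMm : Measurable fun a : (S × E) × E => ((θ a.1.1, a.2), a.1.2) := by fun_prop
  have : IsProbabilityMeasure M := Measure.isProbabilityMeasure_map hMm.aemeasurable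
  have hMfst : M.fst = m := by
    refine Measure.ext_of_lintegral _ fun G hG => ?_
    conv_rhs => rw [← hm]
    rw [Measure.fst, lintegral_map hG measurable_fst, lintegral_map (by fun_prop) hMm,
      Measure.lintegral_compProd (by fun_prop), Measure.lintegral_bind (Kernel.aemeasurable _)
        hG.aemeasurable]
    exact lintegral_congr fun w => (lintegral_skewKernel θ.measurable κ w hG).symm
  obtain ⟨T, hTM, hT⟩ := exists_trajectory_kernel θ.symm.measurable M.condKernel
  let Λ : Measure (S × (ℕ → E)) := (m ⊗ₘ T).map fun a => (a.1.1, a.2)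
  have hΛm : Measurable fun a : (S × E) × (ℕ → E) => (a.1.1, a.2) := by fun_prop
  have hΛ : ∀ G : S × (ℕ → E) → ℝ≥0∞, Measurable G →
      ∫⁻ p, G p ∂Λ = ∫⁻ w, ∫⁻ p, G (w.1, p) ∂(T w) ∂m := by
    intro G hG
    rw [lintegral_map hG hΛm, Measure.lintegral_compProd (by fun_prop)]
  refine ⟨Λ, Measure.isProbabilityMeasure_map hΛm.aemeasurable, ?_, ?_⟩
  · refine Measure.ext_of_lintegral _ fun G hG => ?_
    have hKm : Measurable fun a : (S × E) × (ℕ → E) =>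
        ∫⁻ z, G (θ a.1.1, consSeq z a.2) ∂(κ a.1) :=
      Measurable.lintegral_kernel_prod_right' (κ := κ.comap Prod.fst measurable_fst)
        (f := fun b : ((S × E) × (ℕ → E)) × E => G (θ b.1.1.1, consSeq b.2 b.1.2)) (by fun_prop)
    have hGm : Measurable fun a : (S × E) × E =>
        ∫⁻ p, G (a.1.1, consSeq a.1.2 p) ∂(T (θ.symm a.1.1, a.2)) :=
      Measurable.lintegral_kernel_prod_right'
        (κ := T.comap (fun a : (S × E) × E => (θ.symm a.1.1, a.2)) (by fun_prop))
        (f := fun b : ((S × E) × E) × (ℕ → E) => G (b.1.1.1, consSeq b.1.1.2 b.2)) (by fun_prop)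
    rw [Measure.lintegral_bind (Kernel.aemeasurable _) hG.aemeasurable,
      hΛ _ (hG.lintegral_kernel), hΛ G hG]
    calc _ = ∫⁻ w, ∫⁻ p, ∫⁻ z, G (θ w.1, consSeq z p) ∂(κ w) ∂(T w) ∂m := by
          refine lintegral_congr fun w => ?_
          simp only [lintegral_pastKernel θ.measurable κ _ hG]
          -- The backward path starts at `w.2`, so the transition out of its head is the one out of
          -- `w`.
          exact lintegral_trajectory_head hT w
            (H := fun a => ∫⁻ z, G (θ w.1, consSeq z a.2) ∂(κ (w.1, a.1)))
            (hKm.comp (by fun_prop : Measurable fun a : E × (ℕ → E) => ((w.1, a.1), a.2)))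
      _ = ∫⁻ w, ∫⁻ z, ∫⁻ p, G (θ w.1, consSeq z p) ∂(T w) ∂(κ w) ∂m := by
          refine lintegral_congr fun w => ?_
          exact lintegral_lintegral_swap (by fun_prop)
      _ = ∫⁻ a, ∫⁻ p, G (a.1.1, consSeq a.1.2 p) ∂(T (θ.symm a.1.1, a.2)) ∂M := by
          have hc := hGm.comp hMm
          simp only [Function.comp_def] at hc
          rw [lintegral_map hGm hMm, Measure.lintegral_compProd hc]
          simp
      _ = ∫⁻ w, ∫⁻ y, ∫⁻ p, G (w.1, consSeq w.2 p) ∂(T (θ.symm w.1, y)) ∂(M.condKernel w) ∂m := by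
          conv_lhs => rw [← M.disintegrate M.condKernel, hMfst]
          rw [Measure.lintegral_compProd hGm]
      _ = _ := lintegral_congr fun w => (hT w (fun p => G (w.1, p)) (by fun_prop)).symm
  · refine Measure.ext_of_lintegral _ fun G hG => ?_
    rw [lintegral_map hG (by fun_prop), hΛ _ (by fun_prop)]
    refine lintegral_congr fun w => ?_
    rw [lintegral_trajectory_head hT w (H := fun a => G (w.1, a.1)) (by fun_prop)]
    simp

end Past


/-! ### Measures observed through increasingly fine maps -/

section IncreasingMaps

universe u

variable {α : Type u} {β : Type*} [MeasurableSpace β]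

/-- The sets observed by one of the maps `g n`. -/
def observedSets (g : ℕ → α → β) : Set (Set α) :=
  {s | ∃ n t, MeasurableSet t ∧ g n ⁻¹' t = s}

theorem observedSets_le {g : ℕ → α → β} (hh : ∀ n, ∃ r : β → β, Measurable r ∧ g n = r ∘ g (n + 1))
    {n k : ℕ} (hnk : n ≤ k) {t : Set β} (ht : MeasurableSet t) :
    ∃ t', MeasurableSet t' ∧ g k ⁻¹' t' = g n ⁻¹' t := by
  induction k, hnk using Nat.le_induction with
  | base => exact ⟨t, ht, rfl⟩
  | succ k _ ih =>
    obtain ⟨t', ht', he⟩ := ih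
    obtain ⟨r, hr, hg⟩ := hh k
    exact ⟨r ⁻¹' t', hr ht', by rw [← he, hg, Set.preimage_comp]⟩

theorem isSetAlgebra_observedSets {g : ℕ → α → β}
    (hh : ∀ n, ∃ r : β → β, Measurable r ∧ g n = r ∘ g (n + 1)) :
    IsSetAlgebra (observedSets g) where
  empty_mem := ⟨0, ∅, .empty, rfl⟩
  compl_mem := by
    rintro _ ⟨n, t, ht, rfl⟩
    exact ⟨n, tᶜ, ht.compl, rfl⟩
  union_mem := by
    rintro _ _ ⟨n, t, ht, rfl⟩ ⟨n', t', ht', rfl⟩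
    obtain ⟨u, hu, he⟩ := observedSets_le hh (le_max_left n n') ht
    obtain ⟨u', hu', he'⟩ := observedSets_le hh (le_max_right n n') ht'
    exact ⟨max n n', u ∪ u', hu.union hu', by rw [Set.preimage_union, he, he']⟩

/-- The hypothesis `hgen` is applied to the identity whose domain carries the generated σ-algebra;
its measurability is the nontrivial inclusion. -/
theorem generateFrom_observedSets [mα : MeasurableSpace α] {g : ℕ → α → β} (hg : ∀ n, Measurable (g n))
    (hgen : ∀ (γ : Type u) [MeasurableSpace γ] (φ : γ → α), (∀ n, Measurable fun c => g n (φ c)) →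
      Measurable φ) :
    mα = MeasurableSpace.generateFrom (observedSets g) := by
  refine le_antisymm (fun s hs => ?_) (MeasurableSpace.generateFrom_le ?_)
  · exact @hgen α (MeasurableSpace.generateFrom (observedSets g)) id
      (fun n t ht => MeasurableSpace.measurableSet_generateFrom ⟨n, t, ht, rfl⟩) s hs
  · rintro _ ⟨n, t, ht, rfl⟩
    exact hg n ht

/-- A finite measure is determined by its images under an increasing generating sequence of
maps. -/
theorem ext_of_map_eq_of_increasing [MeasurableSpace α] {g : ℕ → α → β} (hg : ∀ n, Measurable (g n))
    (hh : ∀ n, ∃ r : β → β, Measurable r ∧ g n = r ∘ g (n + 1))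
    (hgen : ∀ (γ : Type u) [MeasurableSpace γ] (φ : γ → α), (∀ n, Measurable fun c => g n (φ c)) →
      Measurable φ)
    {μ ν : Measure α} [IsFiniteMeasure μ] (h : ∀ n, μ.map (g n) = ν.map (g n)) : μ = ν := by
  have key : ∀ n t, MeasurableSet t → μ (g n ⁻¹' t) = ν (g n ⁻¹' t) := fun n t ht => by
    rw [← Measure.map_apply (hg n) ht, h, Measure.map_apply (hg n) ht]
  refine ext_of_generate_finite _ (generateFrom_observedSets hg hgen)
    (isSetAlgebra_observedSets hh).isSetRing.isSetSemiring.isPiSystem ?_ (key 0 _ .univ)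
  rintro _ ⟨n, t, ht, rfl⟩
  exact key n t ht

end IncreasingMaps

/-! ### The present determines the past -/

section PastUniqueness

variable {S E : Type*} [MeasurableSpace S] [MeasurableSpace E]
  {θ : S → S}

theorem bind_skewKernel_of_bind_pastKernel (hθ : Measurable θ) (κ : Kernel (S × E) E)
    [IsMarkovKernel κ] {Λ : Measure (S × (ℕ → E))}
    (h : Λ.bind (pastKernel θ κ) = Λ) :
    (Λ.map fun p => (p.1, p.2 0)).bind (skewKernel hθ κ) = Λ.map fun p => (p.1, p.2 0) := by
  refine Measure.ext_of_lintegral _ fun G hG => ?_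
  conv_rhs => rw [← h]
  rw [Measure.lintegral_bind (Kernel.aemeasurable _) hG.aemeasurable,
    lintegral_map hG.lintegral_kernel (by fun_prop), lintegral_map hG (by fun_prop),
    Measure.lintegral_bind (Kernel.aemeasurable _)
      (by fun_prop : Measurable fun p : S × (ℕ → E) => G (p.1, p.2 0)).aemeasurable]
  refine lintegral_congr fun p => ?_
  rw [lintegral_skewKernel hθ κ _ hG, lintegral_pastKernel hθ κ p (by fun_prop)]
  rfl

/-- The last `n + 1` letters of a past, repeated constantly before. -/
def truncPast {S E : Type*} (n : ℕ) (p : S × (ℕ → E)) : S × (ℕ → E) := (p.1, fun k => p.2 (min k n))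

theorem measurable_truncPast (n : ℕ) :
    Measurable (truncPast n : S × (ℕ → E) → S × (ℕ → E)) := by
  unfold truncPast
  fun_prop

/-- Invariant laws of pasts are determined by the law of the present. -/
theorem eq_of_bind_pastKernel (hθ : Measurable θ) (κ : Kernel (S × E) E) [IsMarkovKernel κ] {Λ Λ' : Measure (S × (ℕ → E))} [IsFiniteMeasure Λ]
    (h : Λ.bind (pastKernel θ κ) = Λ) (h' : Λ'.bind (pastKernel θ κ) = Λ')
    (h0 : (Λ.map fun p => (p.1, p.2 0)) = Λ'.map fun p => (p.1, p.2 0)) : Λ = Λ' := by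
  refine ext_of_map_eq_of_increasing (g := truncPast) measurable_truncPast (fun n => ?_) ?_
    fun n => ?_
  · refine ⟨truncPast n, measurable_truncPast n, ?_⟩
    funext p
    simp only [truncPast, Function.comp]
    congr 1
    funext k
    lia
  · intro γ _ φ hφ
    have h2 : ∀ k, Measurable fun c => (φ c).2 k := by
      intro k
      have := ((measurable_pi_apply k).comp measurable_snd).comp (hφ k)
      simpa [truncPast, Function.comp_def] using this
    exact (measurable_fst.comp (hφ 0)).prodMk (measurable_pi_lambda _ h2)
  · have step : ∀ {Λ : Measure (S × (ℕ → E))}, Λ.bind (pastKernel θ κ) = Λ → ∀ n,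
        ∀ G : S × (ℕ → E) → ℝ≥0∞, Measurable G → ∫⁻ p, G p ∂(Λ.map (truncPast (n + 1))) =
          ∫⁻ p, ∫⁻ z, G (θ p.1, consSeq z p.2) ∂(κ (p.1, p.2 0)) ∂(Λ.map (truncPast n)) := by
      intro Λ hΛ n G hG
      have hm1 : Measurable fun p => G (truncPast (n + 1) p) := hG.comp (measurable_truncPast _)
      have hm2 : Measurable fun p : S × (ℕ → E) =>
          ∫⁻ z, G (θ p.1, consSeq z p.2) ∂(κ (p.1, p.2 0)) :=
        Measurable.lintegral_kernel_prod_right'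
          (κ := κ.comap (fun p : S × (ℕ → E) => (p.1, p.2 0)) (by fun_prop))
          (f := fun b : (S × (ℕ → E)) × E => G (θ b.1.1, consSeq b.2 b.1.2)) (by fun_prop)
      rw [lintegral_map hG (measurable_truncPast _), lintegral_map hm2 (measurable_truncPast _)]
      conv_lhs => rw [← hΛ]
      rw [Measure.lintegral_bind (Kernel.aemeasurable _) hm1.aemeasurable]
      refine lintegral_congr fun p => ?_
      rw [lintegral_pastKernel hθ κ p hm1]
      refine lintegral_congr fun z => ?_
      congr 1
      simp only [truncPast]
      congr 1
      funext k
      cases k with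
      | zero => simp
      | succ k => simp [Nat.succ_min_succ]
    induction n with
    | zero =>
      have he : (truncPast 0 : S × (ℕ → E) → S × (ℕ → E)) =
          (fun w : S × E => (w.1, fun _ => w.2)) ∘ fun p => (p.1, p.2 0) := by
        funext p; simp [truncPast]
      rw [he, ← Measure.map_map (by fun_prop) (by fun_prop), h0,
        Measure.map_map (by fun_prop) (by fun_prop)]
    | succ n ih =>
      refine Measure.ext_of_lintegral _ fun G hG => ?_
      rw [step h n G hG, step h' n G hG, ih]

end PastUniqueness

/-! ### Invariant laws of two-sided paths -/

section TwoSided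

variable {E F : Type*} [MeasurableSpace E] [MeasurableSpace F]

theorem measurable_shift : Measurable (shift : (ℤ → F) → ℤ → F) := by
  unfold shift
  fun_prop

/-- The shift as a measurable equivalence. -/
def shiftEquiv : (ℤ → F) ≃ᵐ (ℤ → F) where
  toFun := shift
  invFun z := fun t => z (t - 1)
  left_inv z := by funext t; simp [shift]
  right_inv z := by funext t; simp [shift]
  measurable_toFun := measurable_shift
  measurable_invFun := measurable_pi_lambda _ fun t => measurable_pi_apply _

theorem shift_iterate {S : Type*} (n : ℕ) (z : ℤ → S) (t : ℤ) : shift^[n] z t = z (t + n) := by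
  induction n generalizing z with
  | zero => simp
  | succ n ih =>
    rw [Function.iterate_succ_apply, ih, shift]
    congr 1
    push_cast
    ring

/-- The transition kernel in the environment seen from the present. -/
noncomputable def envKernel (P : Kernel (F × E) E) : Kernel ((ℤ → F) × E) E :=
  P.comap (fun w => (w.1 0, w.2)) (by fun_prop)

instance (P : Kernel (F × E) E) [IsMarkovKernel P] : IsMarkovKernel (envKernel P) := by
  unfold envKernel; infer_instance

/-- The transition kernel given the environment and the past of the chain. -/
noncomputable def stepKernel (P : Kernel (F × E) E) : Kernel ((ℤ → F) × (ℕ → E)) E :=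
  (envKernel P).comap (fun p => (p.1, p.2 0)) (by fun_prop)

instance (P : Kernel (F × E) E) [IsMarkovKernel P] : IsMarkovKernel (stepKernel P) := by
  unfold stepKernel; infer_instance

/-- The environment and the past of the chain up to time zero. -/
def pastMap {E F : Type*} (z : ℤ → E × F) : (ℤ → F) × (ℕ → E) :=
  (fun s => (z s).2, fun k => (z (-(k : ℤ))).1)

theorem measurable_pastMap : Measurable (pastMap : (ℤ → E × F) → (ℤ → F) × (ℕ → E)) := by
  unfold pastMap
  fun_prop

theorem pastMap_shift {E F : Type*} (z : ℤ → E × F) :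
    pastMap (shift z) = (shift (pastMap z).1, consSeq (z 1).1 (pastMap z).2) := by
  unfold pastMap
  congr 1
  funext k
  cases k with
  | zero => simp [shift]
  | succ k => simp [shift]

/-- The past at time n is recovered from that at n + 1 by dropping the newest letter and shifting
the environment back. -/
theorem pastMap_iterate_eq_comp (n : ℕ) :
    ∃ r : (ℤ → F) × (ℕ → E) → (ℤ → F) × (ℕ → E), Measurable r ∧
      (fun z : ℤ → E × F => pastMap (shift^[n] z)) = r ∘ fun z => pastMap (shift^[n + 1] z) := by
  refine ⟨fun p => (fun s => p.1 (s - 1), fun k => p.2 (k + 1)), by fun_prop, ?_⟩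
  funext z
  simp only [Function.comp, Function.iterate_succ_apply', pastMap_shift]
  simp [shift]

/-- The letter at time t is visible from time max(t, 0), at lag max(t, 0) - t. -/
theorem measurable_of_pastMap_iterate {γ : Type*} [MeasurableSpace γ] {φ : γ → ℤ → E × F}
    (hφ : ∀ n, Measurable fun c => pastMap (shift^[n] (φ c))) : Measurable φ := by
  refine measurable_pi_lambda _ fun t => ?_
  have h2 := ((measurable_pi_apply t).comp measurable_fst).comp (hφ 0)
  have h1 := ((measurable_pi_apply (t.toNat - t).toNat).comp measurable_snd).comp (hφ t.toNat)
  have ht : -(((t.toNat - t).toNat : ℕ) : ℤ) + (t.toNat : ℤ) = t := by lia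
  simp only [Function.comp_def, pastMap, shift_iterate, ht] at h1
  exact h1.prodMk (by simpa [Function.comp_def, pastMap] using h2)

theorem map_shift_iterate {Q : Measure (ℤ → F)} (hQ : Q.map shift = Q) (n : ℕ) :
    Q.map shift^[n] = Q :=
  (MeasurePreserving.iterate ⟨measurable_shift, hQ⟩ n).map_eq

/-- Shift-invariant laws on the path space under which the chain moves according to `P`. -/
structure IsInvariantChain (P : Kernel (F × E) E) (Q : Measure (ℤ → E × F)) : Prop where
  map_shift : Q.map shift = Q
  map_next : Q.map (fun z => (pastMap z, (z 1).1)) = Q.map pastMap ⊗ₘ stepKernel P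

variable {P : Kernel (F × E) E} [IsMarkovKernel P]

theorem IsInvariantChain.bind_pastKernel {Q : Measure (ℤ → E × F)} [IsProbabilityMeasure Q]
    (hQ : IsInvariantChain P Q) :
    (Q.map pastMap).bind (pastKernel shift (envKernel P)) = Q.map pastMap := by
  refine Measure.ext_of_lintegral _ fun G hG => ?_
  have hGm : Measurable fun a : ((ℤ → F) × (ℕ → E)) × E => G (shift a.1.1, consSeq a.2 a.1.2) := by
    have := measurable_shift (F := F)
    fun_prop
  have hpm := measurable_pastMap (E := E) (F := F)
  rw [Measure.lintegral_bind (Kernel.aemeasurable _) hG.aemeasurable]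
  simp only [lintegral_pastKernel measurable_shift _ _ hG]
  conv_rhs => rw [← hQ.map_shift]
  rw [Measure.map_map hpm measurable_shift,
    lintegral_map hG (hpm.comp measurable_shift)]
  simp only [Function.comp_apply, pastMap_shift]
  have h := congrArg (fun m => ∫⁻ a, G (shift a.1.1, consSeq a.2 a.1.2) ∂m) hQ.map_next
  rw [lintegral_map hGm (by fun_prop), Measure.lintegral_compProd hGm] at h
  rw [h]
  rfl

/-- The law of an invariant chain is determined by that of the environment and present state. -/
theorem IsInvariantChain.ext {Q Q' : Measure (ℤ → E × F)} [IsProbabilityMeasure Q]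
    [IsProbabilityMeasure Q'] (hQ : IsInvariantChain P Q) (hQ' : IsInvariantChain P Q')
    (h : (Q.map fun z => ((fun s => (z s).2 : ℤ → F), (z 0).1)) =
      Q'.map fun z => ((fun s => (z s).2 : ℤ → F), (z 0).1)) : Q = Q' := by
  have hpm := measurable_pastMap (E := E) (F := F)
  have hpast : Q.map pastMap = Q'.map pastMap := by
    have : IsProbabilityMeasure (Q.map pastMap) :=
      Measure.isProbabilityMeasure_map hpm.aemeasurable
    refine eq_of_bind_pastKernel measurable_shift (envKernel P) hQ.bind_pastKernel
      hQ'.bind_pastKernel ?_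
    rw [Measure.map_map (by fun_prop) hpm, Measure.map_map (by fun_prop) hpm]
    exact h
  refine ext_of_map_eq_of_increasing (g := fun n z => pastMap (shift^[n] z))
    (fun n => hpm.comp (measurable_shift.iterate n)) pastMap_iterate_eq_comp
    (fun _ _ φ hφ => measurable_of_pastMap_iterate hφ) fun n => ?_
  change Q.map (pastMap ∘ shift^[n]) = Q'.map (pastMap ∘ shift^[n])
  rw [← Measure.map_map hpm (measurable_shift.iterate n),
    ← Measure.map_map hpm (measurable_shift.iterate n), map_shift_iterate hQ.map_shift,
    map_shift_iterate hQ'.map_shift, hpast]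

/-- Glue an environment, a past and a future into a two-sided path. -/
def glue {E F : Type*} (p : (ℤ → F) × (ℕ → E)) (q : ℕ → E) : ℤ → E × F := fun t =>
  (if 0 < t then q t.toNat else p.2 (-t).toNat, p.1 t)

theorem measurable_glue :
    Measurable fun a : ((ℤ → F) × (ℕ → E)) × (ℕ → E) => glue a.1 a.2 := by
  refine measurable_pi_lambda _ fun t => ?_
  unfold glue
  split_ifs <;> fun_prop

theorem pastMap_glue {E F : Type*} (p : (ℤ → F) × (ℕ → E)) (q : ℕ → E) :
    pastMap (glue p q) = p := by
  unfold pastMap glue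
  ext k <;> simp

/-- The head of the future duplicates the present and is ignored by `glue`; after a shift, `q 0`
plays that role and becomes the newest letter of the past. -/
theorem shift_glue_consSeq {E F : Type*} (p : (ℤ → F) × (ℕ → E)) (y : E) (q : ℕ → E) :
    shift (glue p (consSeq y q)) = glue (shift p.1, consSeq (q 0) p.2) q := by
  funext t
  simp only [shift, glue]
  congr 1
  rcases lt_trichotomy t 0 with h | rfl | h
  · rw [if_neg (by lia), if_neg (by lia)]
    obtain ⟨k, rfl⟩ : ∃ k : ℕ, t = -(k : ℤ) - 1 := ⟨(-t - 1).toNat, by lia⟩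
    have h1 : (-(-(k : ℤ) - 1 + 1)).toNat = k := by lia
    have h2 : (-(-(k : ℤ) - 1)).toNat = k + 1 := by lia
    rw [h1, h2, consSeq_succ]
  · simp
  · rw [if_pos (by lia), if_pos h]
    have h1 : (t + 1).toNat = t.toNat + 1 := by lia
    rw [h1, consSeq_succ]

/-- Every invariant law of pasts extends to an invariant chain. -/
theorem exists_isInvariantChain [StandardBorelSpace E] [Nonempty E]
    {Λ : Measure ((ℤ → F) × (ℕ → E))} [IsProbabilityMeasure Λ]
    (hΛ : Λ.bind (pastKernel shift (envKernel P)) = Λ) :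
    ∃ Q : Measure (ℤ → E × F), IsProbabilityMeasure Q ∧ IsInvariantChain P Q ∧
      Q.map pastMap = Λ := by
  obtain ⟨T, hTM, hT⟩ := exists_trajectory_kernel (measurable_shift (F := F)) (envKernel P)
  let T' : Kernel ((ℤ → F) × (ℕ → E)) (ℕ → E) := T.comap (fun p => (p.1, p.2 0)) (by fun_prop)
  let Q : Measure (ℤ → E × F) := (Λ ⊗ₘ T').map fun a => glue a.1 a.2
  have hgl := measurable_glue (E := E) (F := F)
  have hpm := measurable_pastMap (E := E) (F := F)
  have hsh := measurable_shift (F := F)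
  have hQ : ∀ G : (ℤ → E × F) → ℝ≥0∞, Measurable G →
      ∫⁻ z, G z ∂Q = ∫⁻ p, ∫⁻ q, G (glue p q) ∂(T (p.1, p.2 0)) ∂Λ := by
    intro G hG
    rw [lintegral_map hG hgl, Measure.lintegral_compProd (by fun_prop)]
    rfl
  have hpast : Q.map pastMap = Λ := by
    refine Measure.ext_of_lintegral _ fun G hG => ?_
    rw [lintegral_map hG hpm, hQ _ (by fun_prop)]
    simp [pastMap_glue]
  have hQp : IsProbabilityMeasure Q := Measure.isProbabilityMeasure_map hgl.aemeasurable
  refine ⟨Q, hQp, ⟨?_, ?_⟩, hpast⟩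
  · refine Measure.ext_of_lintegral _ fun G hG => ?_
    have hs := measurable_shift (F := E × F)
    have hin : Measurable fun p : (ℤ → F) × (ℕ → E) => ∫⁻ q, G (glue p q) ∂(T (p.1, p.2 0)) :=
      Measurable.lintegral_kernel_prod_right' (κ := T')
        (f := fun b : ((ℤ → F) × (ℕ → E)) × (ℕ → E) => G (glue b.1 b.2)) (by fun_prop)
    rw [lintegral_map hG hs, hQ _ (by fun_prop), hQ G hG]
    conv_rhs => rw [← hΛ]
    rw [Measure.lintegral_bind (Kernel.aemeasurable _) hin.aemeasurable]
    refine lintegral_congr fun p => ?_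
    rw [lintegral_pastKernel hsh _ _ hin, hT _ _ (by fun_prop)]
    refine lintegral_congr fun z => ?_
    simp only [shift_glue_consSeq]
    exact lintegral_trajectory_head hT (shift p.1, z)
      (H := fun a => G (glue (shift p.1, consSeq a.1 p.2) a.2)) (by fun_prop)
  · rw [hpast]
    refine Measure.ext_of_lintegral _ fun G hG => ?_
    rw [lintegral_map hG (by fun_prop), hQ _ (by fun_prop), Measure.lintegral_compProd hG]
    refine lintegral_congr fun p => ?_
    simp only [pastMap_glue]
    rw [show (fun q : ℕ → E => G (p, (glue p q 1).1)) = fun q => G (p, q 1) from by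
      funext q; simp [glue], hT _ _ (by fun_prop)]
    refine lintegral_congr fun z => ?_
    simp only [consSeq]
    rw [lintegral_trajectory_head hT (shift p.1, z) (H := fun a => G (p, a.1)) (by fun_prop)]
    simp

end TwoSided


/-! ### Conditional probabilities as disintegrations -/

section CondProb

/-- A Markov kernel is a version of the conditional probabilities of `Y` given `Z` if and only if it
disintegrates the joint law. -/
theorem condProb_ae_eq_iff {Ω W E : Type*} [MeasurableSpace Ω] [MeasurableSpace W]
    [MeasurableSpace E] [StandardBorelSpace E] [Nonempty E] {μ : Measure Ω}
    [IsProbabilityMeasure μ] {Z : Ω → W} {Y : Ω → E} (hZ : Measurable Z) (hY : Measurable Y)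
    (κ : Kernel W E) [IsMarkovKernel κ] :
    (∀ A, MeasurableSet A → μ⟦Y ⁻¹' A | MeasurableSpace.comap Z inferInstance⟧ =ᵐ[μ]
      fun ω => (κ (Z ω)).real A) ↔ μ.map (fun ω => (Z ω, Y ω)) = μ.map Z ⊗ₘ κ := by
  constructor
  · intro h
    have : IsProbabilityMeasure (μ.map Z) := Measure.isProbabilityMeasure_map hZ.aemeasurable
    have : IsProbabilityMeasure (μ.map fun ω => (Z ω, Y ω)) :=
      Measure.isProbabilityMeasure_map (by fun_prop)
    refine Measure.ext_prod fun {G A} hG hA => ?_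
    have hκA : Measurable fun w => κ w A := Kernel.measurable_coe κ hA
    rw [Measure.map_apply (by fun_prop) (hG.prod hA), Measure.compProd_apply_prod hG hA,
      setLIntegral_map hG hκA hZ]
    have hG' : MeasurableSet[MeasurableSpace.comap Z inferInstance] (Z ⁻¹' G) := ⟨G, hG, rfl⟩
    have h1 : ∫ ω in Z ⁻¹' G, (μ⟦Y ⁻¹' A | MeasurableSpace.comap Z inferInstance⟧) ω ∂μ =
        ∫ ω in Z ⁻¹' G, (Y ⁻¹' A).indicator (fun _ => (1 : ℝ)) ω ∂μ :=
      setIntegral_condExp hZ.comap_le ((integrable_const _).indicator (hY hA)) hG'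
    rw [integral_congr_ae (ae_restrict_of_ae (h A hA)), integral_indicator_const _ (hY hA),
      measureReal_restrict_apply (hY hA), smul_eq_mul, mul_one] at h1
    simp only [measureReal_def] at h1
    have hκZ : Measurable fun ω => κ (Z ω) A := hκA.comp hZ
    rw [integral_toReal hκZ.aemeasurable
      (Eventually.of_forall fun ω => measure_lt_top _ _),
      ENNReal.toReal_eq_toReal_iff' ?_ (measure_ne_top _ _)] at h1
    · rw [h1, Set.inter_comm]
      rfl
    · refine ne_top_of_le_ne_top (measure_ne_top μ (Z ⁻¹' G)) ?_
      calc _ ≤ ∫⁻ _ in Z ⁻¹' G, 1 ∂μ := lintegral_mono fun ω => prob_le_one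
        _ = _ := by simp
  · intro h A hA
    have h1 := ae_of_ae_map hZ.aemeasurable
      (condDistrib_ae_eq_of_measure_eq_compProd Z hY.aemeasurable h)
    filter_upwards [condDistrib_ae_eq_condExp (μ := μ) hZ hY hA, h1] with ω h2 h3
    rw [← h2, h3]

/-- Recentred at t - 1, the last time whose state is known, the conditioning is on one random
variable of the form `pastMap` of a translated path. -/
theorem envPast_eq_comap {Ω E F : Type*} [MeasurableSpace E] [MeasurableSpace F]
    (Y : ℤ → Ω → E) (X : ℤ → Ω → F) (t : ℤ) :
    envPast Y X t = MeasurableSpace.comap (fun ω => ((fun s => X (s + (t - 1)) ω : ℤ → F),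
      (fun k => Y (-(k : ℤ) + (t - 1)) ω : ℕ → E))) inferInstance := by
  refine le_antisymm (sup_le (iSup_le fun s => ?_) (iSup₂_le fun s hs => ?_)) ?_
  · rintro _ ⟨A, hA, rfl⟩
    refine ⟨{p | p.1 (s - (t - 1)) ∈ A}, ?_, ?_⟩
    · exact (by fun_prop : Measurable fun p : (ℤ → F) × (ℕ → E) => p.1 (s - (t - 1))) hA
    · ext ω; simp
  · rintro _ ⟨A, hA, rfl⟩
    refine ⟨{p | p.2 (t - 1 - s).toNat ∈ A}, ?_, ?_⟩
    · exact (by fun_prop : Measurable fun p : (ℤ → F) × (ℕ → E) => p.2 (t - 1 - s).toNat) hA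
    · ext ω
      have : -((t - 1 - s).toNat : ℤ) + (t - 1) = s := by lia
      change Y (-((t - 1 - s).toNat : ℤ) + (t - 1)) ω ∈ A ↔ Y s ω ∈ A
      rw [this]
  · let _ : MeasurableSpace Ω := envPast Y X t
    rw [← measurable_iff_comap_le]
    refine (measurable_pi_lambda _ fun s => ?_).prodMk (measurable_pi_lambda _ fun k => ?_)
    · rw [measurable_iff_comap_le]
      exact le_sup_of_le_left (le_iSup (fun s => MeasurableSpace.comap (X s) inferInstance) _)
    · rw [measurable_iff_comap_le]
      exact le_sup_of_le_right (le_iSup₂ (f := fun (s : ℤ) (_ : s < t) =>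
        MeasurableSpace.comap (Y s) inferInstance) _ (by lia))

end CondProb

/-! ### Stationary solutions and invariant chains -/

section Solutions

variable {E F : Type*} [MeasurableSpace E] [MeasurableSpace F] [StandardBorelSpace E] [Nonempty E]
  {P : Kernel (F × E) E} [IsMarkovKernel P]

theorem IsStationarySolution.isInvariantChain {Ω : Type*} [MeasurableSpace Ω] {μ : Measure Ω}
    [IsProbabilityMeasure μ] {Y : ℤ → Ω → E} {X : ℤ → Ω → F} {ρ : Measure (ℤ → F)}
    (h : IsStationarySolution P ρ μ Y X) :
    IsInvariantChain P (pathLaw μ fun t ω => (Y t ω, X t ω)) := by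
  have hY := h.chain.measurable_chain
  have hX := h.chain.measurable_env
  have hZ : Measurable fun ω => fun t => (Y t ω, X t ω) := by fun_prop
  have hpm := measurable_pastMap (E := E) (F := F)
  refine ⟨?_, ?_⟩
  · rw [pathLaw, Measure.map_map measurable_shift hZ]
    exact h.stationary.translate 1
  · have hpast : Measurable fun ω => ((fun s => X (s + (1 - 1)) ω : ℤ → F),
      (fun k => Y (-(k : ℤ) + (1 - 1)) ω : ℕ → E)) := by fun_prop
    have hc : ∀ A, MeasurableSet A → _ := h.chain.condProb 1
    rw [envPast_eq_comap] at hc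
    have := (condProb_ae_eq_iff hpast (hY 1) (stepKernel P)).1 fun A hA => by
      refine (hc A hA).trans (Eventually.of_forall fun ω => ?_)
      simp [stepKernel, envKernel]
    rw [pathLaw, Measure.map_map (by fun_prop) hZ, Measure.map_map hpm hZ]
    simpa [Function.comp_def, pastMap] using this

theorem IsInvariantChain.isStationarySolution {Q : Measure (ℤ → E × F)} [IsProbabilityMeasure Q]
    (hQ : IsInvariantChain P Q) {ρ : Measure (ℤ → F)}
    (hρ : Q.map (fun z => (fun s => (z s).2 : ℤ → F)) = ρ) :
    IsStationarySolution P ρ Q (fun t z => (z t).1) (fun t z => (z t).2) := by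
  have htr : ∀ h : ℤ, Q.map (fun z t => z (t + h)) = Q := by
    intro h
    rcases Int.eq_nat_or_neg h with ⟨n, rfl | rfl⟩
    · conv_rhs => rw [← map_shift_iterate hQ.map_shift n]
      congr 1
      funext z t
      exact (shift_iterate n z t).symm
    -- A backward translation is undone by inserting n forward shifts, which preserve `Q`.
    · conv_lhs => rw [← map_shift_iterate hQ.map_shift n]
      rw [Measure.map_map (by fun_prop) (measurable_shift.iterate n)]
      convert Measure.map_id using 2
      funext z t
      simp [shift_iterate]
  have hpm := measurable_pastMap (E := E) (F := F)
  refine ⟨⟨fun t => by fun_prop, fun h => ?_⟩, hρ, ⟨fun t => by fun_prop, fun t => by fun_prop, ?_⟩⟩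
  · exact (htr h).trans Measure.map_id.symm
  · intro t A hA
    rw [envPast_eq_comap]
    -- `map_next` concerns only the step from 0 to 1; translation by t - 1 gives the step into t.
    have hT : Measurable fun (z : ℤ → E × F) s => z (s + (t - 1)) := by fun_prop
    have hnext := hQ.map_next
    rw [← htr (t - 1), Measure.map_map (by fun_prop) hT, Measure.map_map hpm hT] at hnext
    have := (condProb_ae_eq_iff (hpm.comp hT) (by fun_prop) (stepKernel P)).2 hnext A hA
    simpa [Function.comp_def, pastMap, stepKernel, envKernel] using this

end Solutions

/-! ### Conditioning on invariant events -/

section Ergodicity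

variable {E F : Type*} [MeasurableSpace E] [MeasurableSpace F]
  {P : Kernel (F × E) E} [IsMarkovKernel P]

/-- Shift-invariant events are approximated by events of the past. -/
theorem exists_past_symmDiff_lt {Q : Measure (ℤ → E × F)} [IsProbabilityMeasure Q]
    (hQ : Q.map shift = Q) {A : Set (ℤ → E × F)} (hA : MeasurableSet A) (hAs : shift ⁻¹' A = A)
    {ε : ℝ} (hε : 0 < ε) :
    ∃ G, MeasurableSet G ∧ Q (symmDiff A (pastMap ⁻¹' G)) < ENNReal.ofReal ε := by
  have hpm := measurable_pastMap (E := E) (F := F)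
  have hd := Measure.MeasureDense.of_generateFrom_isSetAlgebra_finite Q
    (isSetAlgebra_observedSets (g := fun n (z : ℤ → E × F) => pastMap (shift^[n] z))
      pastMap_iterate_eq_comp)
    (generateFrom_observedSets (fun n => hpm.comp (measurable_shift.iterate n))
      fun _ _ φ hφ => measurable_of_pastMap_iterate hφ)
  obtain ⟨_, ⟨n, G, hG, rfl⟩, h⟩ := hd.approx A hA (measure_ne_top _ _) ε hε
  refine ⟨G, hG, ?_⟩
  -- Invariance of `A` and of `Q` brings an approximation observed up to time n back to time 0.
  have hAn : shift^[n] ⁻¹' A = A := by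
    rw [Set.preimage_iterate_eq]
    exact Function.iterate_fixed hAs n
  rw [← map_shift_iterate hQ n, Measure.map_apply (measurable_shift.iterate n)
    (hA.symmDiff (hpm hG)), Set.preimage_symmDiff, hAn]
  exact h

/-- Conditioning on an event of the past does not affect the next transition, and an invariant event
is a limit of such events. -/
theorem IsInvariantChain.cond {Q : Measure (ℤ → E × F)} [IsProbabilityMeasure Q]
    (hQ : IsInvariantChain P Q) {A : Set (ℤ → E × F)} (hA : MeasurableSet A)
    (hAs : shift ⁻¹' A = A) : IsInvariantChain P (Q[|A]) := by
  have hpm := measurable_pastMap (E := E) (F := F)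
  have hN : Measurable fun z : ℤ → E × F => (pastMap z, (z 1).1) := by fun_prop
  have hshift : (Q.restrict A).map shift = Q.restrict A := by
    conv_lhs => rw [← hAs]
    rw [← Measure.restrict_map measurable_shift hA, hQ.map_shift]
  have hnext : (Q.restrict A).map (fun z => (pastMap z, (z 1).1)) =
      (Q.restrict A).map pastMap ⊗ₘ stepKernel P := by
    -- Total masses agree, so one inequality suffices. Replacing `A` by a past event and back costs
    -- ε/2 each time.
    refine Measure.eq_of_le_of_measure_univ_eq (Measure.le_iff.2 fun H hH => ?_) ?_
    · have hsH : Measurable fun p => stepKernel P p (Prod.mk p ⁻¹' H) :=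
        Kernel.measurable_kernel_prodMk_left hH
      rw [Measure.map_apply hN hH, Measure.restrict_apply (hN hH), Measure.compProd_apply hH,
        lintegral_map hsH hpm]
      refine ENNReal.le_of_forall_pos_le_add fun ε hε _ => ?_
      obtain ⟨G, hG, hlt⟩ := exists_past_symmDiff_lt hQ.map_shift hA hAs
        (half_pos (NNReal.coe_pos.2 hε))
      have hlt' : Q (symmDiff A (pastMap ⁻¹' G)) ≤ (ε / 2 : ℝ≥0) := by
        refine hlt.le.trans (le_of_eq ?_)
        rw [← ENNReal.ofReal_coe_nnreal]
        simp
      set B := pastMap ⁻¹' G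
      have hB : MeasurableSet B := hpm hG
      calc Q ((fun z => (pastMap z, (z 1).1)) ⁻¹' H ∩ A)
          ≤ Q ((fun z => (pastMap z, (z 1).1)) ⁻¹' (H ∩ G ×ˢ Set.univ) ∪ symmDiff A B) := by
            refine measure_mono fun z hz => ?_
            by_cases hzB : z ∈ B
            · exact Or.inl ⟨hz.1, hzB, Set.mem_univ _⟩
            · exact Or.inr (Or.inl ⟨hz.2, hzB⟩)
        _ ≤ Q ((fun z => (pastMap z, (z 1).1)) ⁻¹' (H ∩ G ×ˢ Set.univ)) + (ε / 2 : ℝ≥0) :=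
            (measure_union_le _ _).trans (by gcongr)
        _ = (∫⁻ z in B, stepKernel P (pastMap z) (Prod.mk (pastMap z) ⁻¹' H) ∂Q) +
              (ε / 2 : ℝ≥0) := by
            have hHG := hH.inter (hG.prod MeasurableSet.univ)
            rw [← Measure.map_apply hN hHG, hQ.map_next, Measure.compProd_apply hHG,
              lintegral_map (Kernel.measurable_kernel_prodMk_left hHG) hpm,
              ← lintegral_indicator hB]
            congr 1
            refine lintegral_congr fun z => ?_
            by_cases hz : pastMap z ∈ G
            · rw [Set.indicator_of_mem (show z ∈ B from hz)]
              congr 1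
              ext y; simp [hz]
            · rw [Set.indicator_of_notMem (show z ∉ B from hz)]
              convert measure_empty (μ := stepKernel P (pastMap z))
              ext y; simp [hz]
        _ ≤ (∫⁻ z in A ∪ symmDiff A B, stepKernel P (pastMap z) (Prod.mk (pastMap z) ⁻¹' H) ∂Q) +
              (ε / 2 : ℝ≥0) := by
            gcongr
            intro z hz
            by_cases hzA : z ∈ A
            · exact Or.inl hzA
            · exact Or.inr (Or.inr ⟨hz, hzA⟩)
        _ ≤ (∫⁻ z in A, stepKernel P (pastMap z) (Prod.mk (pastMap z) ⁻¹' H) ∂Q) +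
              (∫⁻ z in symmDiff A B, stepKernel P (pastMap z) (Prod.mk (pastMap z) ⁻¹' H) ∂Q) +
              (ε / 2 : ℝ≥0) := by
            gcongr
            exact lintegral_union_le _ _ _
        _ ≤ (∫⁻ z in A, stepKernel P (pastMap z) (Prod.mk (pastMap z) ⁻¹' H) ∂Q) +
              (ε / 2 : ℝ≥0) + (ε / 2 : ℝ≥0) := by
            gcongr
            calc _ ≤ ∫⁻ _ in symmDiff A B, 1 ∂Q := lintegral_mono fun z => prob_le_one
              _ = Q (symmDiff A B) := by simp
              _ ≤ _ := hlt'
        _ = _ := by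
            rw [add_assoc, ← ENNReal.coe_add, add_halves]
    · rw [Measure.map_apply hN .univ, Measure.compProd_apply_univ, Measure.map_apply hpm .univ]
      rfl
  refine ⟨?_, ?_⟩
  · rw [ProbabilityTheory.cond, Measure.map_smul, hshift]
  · rw [ProbabilityTheory.cond, Measure.map_smul, Measure.map_smul, hnext,
      Measure.compProd_smul_left]

end Ergodicity


/-! ### Uniqueness and ergodicity of invariant chains -/

section Main

variable {E F Ω : Type*} [MeasurableSpace E] [MeasurableSpace F] [MeasurableSpace Ω]

theorem SmallSetCondition.hasSmallSets {P : Kernel (F × E) E} {V : E → ℝ≥0} {η : ℝ≥0 → F → ℝ≥0}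
    (h : SmallSetCondition P V η) : HasSmallSets (envKernel P) V := by
  intro R hR
  obtain ⟨ν, hν, hmin⟩ := h.minorization R hR
  have hηR : Measurable (η R) := h.measurable.comp measurable_prodMk_left
  refine ⟨fun x => η R (x 0), by fun_prop, fun x => ENNReal.coe_pos.2 (h.mem_Ioo R hR _).1,
    ν.comap (fun x => x 0) (measurable_pi_apply 0), inferInstance, fun x y hy A hA => ?_⟩
  exact hmin (x 0) y hy A hA

/-- The environment over which a path lives, together with its present state. -/
theorem map_pastMap_present (Q : Measure (ℤ → E × F)) :
    (Q.map pastMap).map (fun p => (p.1, p.2 0)) =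
      Q.map fun z => ((fun s => (z s).2 : ℤ → F), (z 0).1) := by
  rw [Measure.map_map (by fun_prop) measurable_pastMap]
  rfl

theorem IsInvariantChain.bind_skewKernel {P : Kernel (F × E) E} [IsMarkovKernel P]
    {Q : Measure (ℤ → E × F)} [IsProbabilityMeasure Q] (hQ : IsInvariantChain P Q) :
    (Q.map fun z => ((fun s => (z s).2 : ℤ → F), (z 0).1)).bind
        (skewKernel measurable_shift (envKernel P)) =
      Q.map fun z => ((fun s => (z s).2 : ℤ → F), (z 0).1) := by
  rw [← map_pastMap_present]
  exact bind_skewKernel_of_bind_pastKernel measurable_shift _ hQ.bind_pastKernel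

/-- Invariant chains over the same environment have the same law. -/
theorem IsInvariantChain.eq_of_env {P : Kernel (F × E) E} [IsMarkovKernel P] {V : E → ℝ≥0}
    (hV : Measurable V) (hs : HasSmallSets (envKernel P) V) {Q Q' : Measure (ℤ → E × F)}
    [IsProbabilityMeasure Q] [IsProbabilityMeasure Q'] (hQ : IsInvariantChain P Q)
    (hQ' : IsInvariantChain P Q')
    (h : Q.map (fun z => (fun s => (z s).2 : ℤ → F)) = Q'.map fun z => fun s => (z s).2) :
    Q = Q' := by
  refine hQ.ext hQ' (eq_of_invariant measurable_shift (envKernel P) hV hs hQ.bind_skewKernel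
    hQ'.bind_skewKernel ?_)
  rw [Measure.map_map measurable_fst (by fun_prop), Measure.map_map measurable_fst (by fun_prop)]
  exact h

theorem IsInvariantChain.ergodic {P : Kernel (F × E) E} [IsMarkovKernel P] {V : E → ℝ≥0}
    (hV : Measurable V) (hs : HasSmallSets (envKernel P) V) {Q : Measure (ℤ → E × F)}
    [IsProbabilityMeasure Q] (hQ : IsInvariantChain P Q)
    (he : Ergodic shift (Q.map fun z => (fun s => (z s).2 : ℤ → F))) :
    Ergodic shift Q := by
  have henv : Measurable fun z : ℤ → E × F => (fun s => (z s).2 : ℤ → F) := by fun_prop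
  refine ⟨⟨measurable_shift, hQ.map_shift⟩, ⟨fun A hA hAs => ?_⟩⟩
  rw [eventuallyConst_set']
  by_cases h0 : Q A = 0
  · exact Or.inl (ae_eq_empty.2 h0)
  right
  have : IsProbabilityMeasure (Q[|A]) := cond_isProbabilityMeasure h0
  have : IsProbabilityMeasure (Q.map fun z => (fun s => (z s).2 : ℤ → F)) :=
    Measure.isProbabilityMeasure_map henv.aemeasurable
  have : IsProbabilityMeasure ((Q[|A]).map fun z => (fun s => (z s).2 : ℤ → F)) :=
    Measure.isProbabilityMeasure_map henv.aemeasurable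
  have hc := hQ.cond hA hAs
  have hpres : MeasurePreserving shift ((Q[|A]).map fun z => (fun s => (z s).2 : ℤ → F))
      ((Q[|A]).map fun z => (fun s => (z s).2 : ℤ → F)) := by
    refine ⟨measurable_shift, ?_⟩
    conv_rhs => rw [← hc.map_shift]
    rw [Measure.map_map measurable_shift henv, Measure.map_map henv measurable_shift]
    rfl
  -- An ergodic law admits no other invariant probability absolutely continuous with respect to it.
  have heq := he.eq_of_absolutelyContinuous hpres (cond_absolutelyContinuous.map henv)
  have hQA : Q[|A] = Q := hc.eq_of_env hV hs hQ heq
  have h1 : Q A = 1 := by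
    rw [← hQA]
    exact cond_apply_self h0 (measure_ne_top Q A)
  have h2 := (prob_compl_eq_zero_iff hA).2 h1
  exact ae_eq_univ.2 h2

end Main

end MCRE

theorem theorem1 {E F Ω : Type*}
    [TopologicalSpace E] [PolishSpace E] [MeasurableSpace E] [BorelSpace E]
    [TopologicalSpace F] [PolishSpace F] [MeasurableSpace F] [BorelSpace F]
    [MeasurableSpace Ω] (μ : Measure Ω) [IsProbabilityMeasure μ]
    (P : Kernel (F × E) E) [IsMarkovKernel P] (X : ℤ → Ω → F)
    (hX : MCRE.IsStationaryProcess μ X)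
    (V : E → ℝ≥0) (lam b : F → ℝ≥0) (hV : MCRE.DriftCondition P μ X V lam b)
    (η : ℝ≥0 → F → ℝ≥0) (hη : MCRE.SmallSetCondition P V η) :
    ∃ Q : Measure (ℤ → E × F), IsProbabilityMeasure Q ∧
      -- existence: under `Q` the coordinate process is a stationary solution
      MCRE.IsStationarySolution P (MCRE.pathLaw μ X) Q
        (fun t z => (z t).1) (fun t z => (z t).2) ∧
      -- uniqueness: every stationary solution, on any probability space, has the law `Q`
      (∀ (Ω' : Type*) [MeasurableSpace Ω'] (μ' : Measure Ω') [IsProbabilityMeasure μ']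
        (Y' : ℤ → Ω' → E) (X' : ℤ → Ω' → F),
        MCRE.IsStationarySolution P (MCRE.pathLaw μ X) μ' Y' X' →
          MCRE.pathLaw μ' (fun t ω => (Y' t ω, X' t ω)) = Q) ∧
      -- ergodicity of the environment is inherited
      (MCRE.IsErgodicProcess μ X →
        MCRE.IsErgodicProcess Q (fun t (z : ℤ → E × F) => z t)) := by
  have hXm := hX.measurable
  have hXp : Measurable fun ω => fun t => X t ω := measurable_pi_lambda _ hXm
  set ρ := MCRE.pathLaw μ X with hρdef
  have hρp : IsProbabilityMeasure ρ := Measure.isProbabilityMeasure_map hXp.aemeasurable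
  have hρ : ρ.map MCRE.shift = ρ := by
    rw [hρdef, MCRE.pathLaw, Measure.map_map MCRE.measurable_shift hXp]
    exact hX.translate 1
  -- Ω is nonempty as it carries a probability, so some ν_x exists and charges `E`.
  have hE : Nonempty E := by
    obtain ⟨ω⟩ := nonempty_of_isProbabilityMeasure μ
    obtain ⟨ν, hν, -⟩ := hη.minorization 1 one_pos
    exact nonempty_of_isProbabilityMeasure (ν (X 0 ω))
  obtain ⟨y₀⟩ := id hE
  have hs := hη.hasSmallSets
  have hlam := hV.logMoment_lam.measurable
  have hb := hV.logMoment_b.measurable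
  have hmk : Measurable fun x : ℤ → F => (x, y₀) := by fun_prop
  have : IsProbabilityMeasure (ρ.map fun x => (x, y₀)) :=
    Measure.isProbabilityMeasure_map hmk.aemeasurable
  obtain ⟨m, hmp, hm, hmρ⟩ := MCRE.exists_invariant MCRE.measurable_shift (MCRE.envKernel P)
    hV.measurable hs hρ (m₀ := ρ.map fun x => (x, y₀))
    (by rw [Measure.map_map measurable_fst hmk]; exact Measure.map_id)
    fun ε hε => MCRE.tight_iterLaw MCRE.measurable_shift (MCRE.envKernel P) hV.measurable
      (lam := fun x => lam (x 0)) (b := fun x => b (x 0)) (by fun_prop) (by fun_prop)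
      (fun w => hV.drift (w.1 0) w.2) hρ
      (MCRE.measurable_driftBound hlam hb (V y₀)) (fun x => by simp [MCRE.driftBound])
      (MCRE.driftBound_succ_shift lam b (V y₀)) (MCRE.ae_iSup_driftBound_lt_top hX hV (V y₀)) hε
  obtain ⟨Λ, hΛp, hΛ, hΛm⟩ := MCRE.exists_invariant_past MCRE.shiftEquiv (MCRE.envKernel P) hm
  obtain ⟨Q, hQp, hQ, hQΛ⟩ := MCRE.exists_isInvariantChain hΛ
  have hQρ : Q.map (fun z => (fun s => (z s).2 : ℤ → F)) = ρ := by
    rw [← hmρ, ← hΛm, ← hQΛ, MCRE.map_pastMap_present,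
      Measure.map_map measurable_fst (by fun_prop)]
    rfl
  refine ⟨Q, hQp, hQ.isStationarySolution hQρ, fun Ω' _ μ' _ Y' X' h => ?_, fun he => ?_⟩
  · have hY' := h.chain.measurable_chain
    have hX' := h.chain.measurable_env
    have hZ' : Measurable fun ω => fun t => (Y' t ω, X' t ω) := by fun_prop
    have : IsProbabilityMeasure (MCRE.pathLaw μ' fun t ω => (Y' t ω, X' t ω)) :=
      Measure.isProbabilityMeasure_map hZ'.aemeasurable
    refine h.isInvariantChain.eq_of_env hV.measurable hs hQ ?_
    rw [hQρ, ← h.env_law, MCRE.pathLaw, Measure.map_map (by fun_prop) hZ']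
    rfl
  · have hid : MCRE.pathLaw Q (fun t (z : ℤ → E × F) => z t) = Q := Measure.map_id
    rw [MCRE.IsErgodicProcess, hid]
    refine hQ.ergodic hV.measurable hs ?_
    rw [hQρ]
    exact he
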